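/- Call two distinct points of $\mathbb{Z}^n$ *$c_1$-adjacent* if they differ by exactly $1$ in one coordinate and agree in all others. A function $f:X\to Y$ between subsets $X\subseteq\mathbb{Z}^n$, $Y\subseteq\mathbb{Z}^m$ is *continuous* if it sends $c_1$-adjacent points of $X$ to points of $Y$ that are $c_1$-adjacent or equal. An *elementary cube* in $\mathbb{Z}^n$ is a set $Q=J_1\times\dots\times J_n$ where each $J_i$ is $\{a\}$ (degenerate) or $\{a,a+1\}$ (nondegenerate) for some $a\in\mathbb{Z}$; it is an elementary $q$-cube if exactly $q$ factors are nondegenerate. Let $\bar C^{c_1}_q(X)$ be the free abelian group on the elementary $q$-cubes $Q\subseteq X$. Let $A_iQ$ and $B_iQ$ be obtained from $Q$ by replacing $J_i$ by $\{\min J_i\}$ and $\{\max J_i\}$ respectively, and for a $q$-cube $Q$ with nondegenerate indices $j_1<\dots<j_q$ put $$\partial_q Q=\sum_{i=1}^q(-1)^i\,(A_{j_i}Q-B_{j_i}Q).$$ Extended linearly, this makes $(\bar C^{c_1}_q(X),\partial_q)_{q\ge 0}$ a chain complex. For a continuous $f:X\to Y$ and an elementary $q$-cube $Q\subseteq X$,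 let $\epsilon_{f,Q}=0$ if $f(Q)$ is not an elementary $q$-cube. If $f(Q)$ is an elementary $q$-cube, let $\epsilon_{f,Q}\in\{-1,1\}$ be the determinant of the linear part of the affine map describing $f|_Q:Q\to f(Q)$, where each of the two cubes is identified with $\{0,1\}^q$ through its nondegenerate coordinates in increasing order. Define $\bar f_\#:\bar C^{c_1}_q(X)\to\bar C^{c_1}_q(Y)$ by $\bar f_\#(Q)=\epsilon_{f,Q}\,f(Q)$ (read as $0$ if $\epsilon_{f,Q}=0$), extended linearly. **Theorem 5.1.** Let $X\subseteq\mathbb{Z}^n$ and $Y\subseteq\mathbb{Z}^m$ be digital images with $c_1$-adjacency and $n\le 4$, and let $f:X\to Y$ be continuous. Then $\bar f_\#:\bar C^{c_1}_q(X)\to\bar C^{c_1}_q(Y)$ is a chain map, that is, $\bar f_\#\circ\partial_q=\partial_q\circ\bar f_\#$ for every $q$. -/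

import Mathlib

noncomputable section

namespace DigitalImage

/-! ### Adjacency and continuity -/

/-- The adjacency `c_k` on `ℤ^n`: two distinct points are adjacent when their coordinates differ
by at most `1` in at most `k` positions and are equal in all other positions. -/
def CAdj (k : ℕ) {n : ℕ} (x y : Fin n → ℤ) : Prop :=
  x ≠ y ∧ (∀ i, |x i - y i| ≤ 1) ∧ (Finset.univ.filter fun i => x i ≠ y i).card ≤ k

/-- The `c_1`-adjacency of the digital image `X ⊆ ℤ^n`. -/
def C1Adj {n : ℕ} (X : Set (Fin n → ℤ)) (x y : X) : Prop :=
  CAdj 1 (x : Fin n → ℤ) (y : Fin n → ℤ)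

/-- `(κ, μ)`-continuity: adjacent points are sent to adjacent or equal points. -/
def IsContinuous {α β : Type*} (κ : α → α → Prop) (μ : β → β → Prop) (f : α → β) : Prop :=
  ∀ x y, κ x y → μ (f x) (f y) ∨ f x = f y

/-! ### Elementary cubes -/

/-- An elementary cube `J_1 × ⋯ × J_n` of `ℤ^n`, given by the end points of the elementary
intervals `J_i = {lo i, hi i}`, where `hi i = lo i` or `hi i = lo i + 1`. -/
@[ext]
structure ElemCube (n : ℕ) where
  lo : Fin n → ℤ
  hi : Fin n → ℤ
  elementary : ∀ i, hi i = lo i ∨ hi i = lo i + 1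

namespace ElemCube

variable {n : ℕ}

/-- The point set `J_1 × ⋯ × J_n`. -/
def toSet (Q : ElemCube n) : Set (Fin n → ℤ) :=
  Set.univ.pi fun i => {Q.lo i, Q.hi i}

theorem lo_le_hi (Q : ElemCube n) (i : Fin n) : Q.lo i ≤ Q.hi i := by
  rcases Q.elementary i with h | h <;> omega

theorem mem_toSet {Q : ElemCube n} {x : Fin n → ℤ} :
    x ∈ Q.toSet ↔ ∀ i, x i = Q.lo i ∨ x i = Q.hi i := by
  simp [toSet]

theorem lo_mem (Q : ElemCube n) : Q.lo ∈ Q.toSet := mem_toSet.2 fun _ => Or.inl rfl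

theorem hi_mem (Q : ElemCube n) : Q.hi ∈ Q.toSet := mem_toSet.2 fun _ => Or.inr rfl

/-- An elementary cube is determined by its point set. -/
theorem toSet_injective : Function.Injective (toSet : ElemCube n → Set (Fin n → ℤ)) := by
  intro Q R h
  have h1 := mem_toSet.1 (h ▸ Q.lo_mem)
  have h2 := mem_toSet.1 (h ▸ Q.hi_mem)
  have h3 := mem_toSet.1 (h.symm ▸ R.lo_mem)
  have h4 := mem_toSet.1 (h.symm ▸ R.hi_mem)
  ext i
  · have := Q.lo_le_hi i
    have := R.lo_le_hi i
    have := h1 i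
    have := h3 i
    omega
  · have := Q.lo_le_hi i
    have := R.lo_le_hi i
    have := h2 i
    have := h4 i
    omega

/-- The indices `i` for which `J_i` is nondegenerate. -/
def nondeg (Q : ElemCube n) : Finset (Fin n) :=
  Finset.univ.filter fun i => Q.lo i ≠ Q.hi i

theorem mem_nondeg {Q : ElemCube n} {i : Fin n} : i ∈ Q.nondeg ↔ Q.lo i ≠ Q.hi i := by
  simp [nondeg]

/-- The dimension of a cube: the number of nondegenerate factors. -/
def dim (Q : ElemCube n) : ℕ := Q.nondeg.card

/-- The increasing sequence `(j_1, …, j_q)` of the nondegenerate indices of a `q`-cube. -/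
def dir (Q : ElemCube n) {q : ℕ} (h : Q.dim = q) : Fin q ↪o Fin n :=
  Q.nondeg.orderEmbOfFin h

/-- The face `A_i Q`: replace `J_i` by `{min J_i}`. -/
def faceA (Q : ElemCube n) (i : Fin n) : ElemCube n where
  lo := Q.lo
  hi := Function.update Q.hi i (Q.lo i)
  elementary k := by
    by_cases h : k = i
    · subst h; simp
    · simpa [h] using Q.elementary k

/-- The face `B_i Q`: replace `J_i` by `{max J_i}`. -/
def faceB (Q : ElemCube n) (i : Fin n) : ElemCube n where
  lo := Function.update Q.lo i (Q.hi i)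
  hi := Q.hi
  elementary k := by
    by_cases h : k = i
    · subst h; simp
    · simpa [h] using Q.elementary k

theorem faceA_subset (Q : ElemCube n) (i : Fin n) : (Q.faceA i).toSet ⊆ Q.toSet := by
  intro x hx
  rw [mem_toSet] at hx ⊢
  intro k
  have := hx k
  by_cases h : k = i
  · subst h; simp [faceA] at this; exact Or.inl this
  · simpa [faceA, h] using this

theorem faceB_subset (Q : ElemCube n) (i : Fin n) : (Q.faceB i).toSet ⊆ Q.toSet := by
  intro x hx
  rw [mem_toSet] at hx ⊢
  intro k
  have := hx k
  by_cases h : k = i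
  · subst h; simp [faceB] at this; exact Or.inr this
  · simpa [faceB, h] using this

theorem nondeg_faceA (Q : ElemCube n) (i : Fin n) : (Q.faceA i).nondeg = Q.nondeg.erase i := by
  ext k
  by_cases h : k = i
  · subst h; simp [mem_nondeg, faceA]
  · simp [mem_nondeg, faceA, h]

theorem nondeg_faceB (Q : ElemCube n) (i : Fin n) : (Q.faceB i).nondeg = Q.nondeg.erase i := by
  ext k
  by_cases h : k = i
  · subst h; simp [mem_nondeg, faceB]
  · simp [mem_nondeg, faceB, h]

theorem dir_mem (Q : ElemCube n) {q : ℕ} (h : Q.dim = q) (i : Fin q) :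
    Q.dir h i ∈ Q.nondeg := Finset.orderEmbOfFin_mem _ _ _

theorem dim_faceA (Q : ElemCube n) {q : ℕ} (h : Q.dim = q + 1) (i : Fin (q + 1)) :
    (Q.faceA (Q.dir h i)).dim = q := by
  rw [dim, nondeg_faceA, Finset.card_erase_of_mem (Q.dir_mem h i)]
  exact Nat.sub_eq_of_eq_add h

theorem dim_faceB (Q : ElemCube n) {q : ℕ} (h : Q.dim = q + 1) (i : Fin (q + 1)) :
    (Q.faceB (Q.dir h i)).dim = q := by
  rw [dim, nondeg_faceB, Finset.card_erase_of_mem (Q.dir_mem h i)]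
  exact Nat.sub_eq_of_eq_add h

theorem dir_of_nondeg_eq (Q R : ElemCube n) {q : ℕ} (h : Q.dim = q + 1) (i : Fin (q + 1))
    (hR : R.dim = q) (hn : R.nondeg = Q.nondeg.erase (Q.dir h i)) (j : Fin q) :
    R.dir hR j = Q.dir h (i.succAbove j) := by
  have := Finset.orderEmbOfFin_unique hR (f := fun j => Q.dir h (i.succAbove j))
    (fun j => by
      rw [hn, Finset.mem_erase]
      exact ⟨fun e => i.succAbove_ne j ((Q.dir h).injective e), Q.dir_mem h _⟩)
    (fun a b hab => (Q.dir h).strictMono (Fin.strictMono_succAbove i hab))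
  exact (congrFun this j).symm

theorem faceA_faceA (Q : ElemCube n) (i k : Fin n) :
    (Q.faceA i).faceA k = (Q.faceA k).faceA i := by
  by_cases h : i = k
  · rw [h]
  · ext l
    · rfl
    · simp only [faceA]; rw [Function.update_comm (Ne.symm h)]

theorem faceB_faceB (Q : ElemCube n) (i k : Fin n) :
    (Q.faceB i).faceB k = (Q.faceB k).faceB i := by
  by_cases h : i = k
  · rw [h]
  · ext l
    · simp only [faceB]; rw [Function.update_comm (Ne.symm h)]
    · rfl

theorem faceA_faceB (Q : ElemCube n) {i k : Fin n} (h : i ≠ k) :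
    (Q.faceA i).faceB k = (Q.faceB k).faceA i := by
  ext l <;> simp [faceA, faceB, h, Ne.symm h]

/-- The vertex of `Q` reached from its minimal vertex by moving to the other end of the
`i`-th factor. -/
def vertex (Q : ElemCube n) (i : Fin n) : Fin n → ℤ := Function.update Q.lo i (Q.hi i)

theorem vertex_mem (Q : ElemCube n) (i : Fin n) : Q.vertex i ∈ Q.toSet := by
  rw [mem_toSet]
  intro k
  by_cases h : k = i
  · subst h; simp [vertex]
  · simp [vertex, h]

end ElemCube

/-! ### The `c_1`-cubical chain complex -/

/-- The elementary `q`-cubes contained in `X`. -/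
abbrev CubeIn {n : ℕ} (X : Set (Fin n → ℤ)) (q : ℕ) : Type :=
  {Q : ElemCube n // Q.dim = q ∧ Q.toSet ⊆ X}

/-- The free abelian group generated by the elementary `q`-cubes in `X`. -/
abbrev Chain {n : ℕ} (X : Set (Fin n → ℤ)) (q : ℕ) : Type := CubeIn X q →₀ ℤ

namespace CubeIn

variable {n : ℕ} {X : Set (Fin n → ℤ)} {q : ℕ}

/-- The face `A_{j_i} Q` for the `i`-th nondegenerate index `j_i`. -/
def faceA (Q : CubeIn X (q + 1)) (i : Fin (q + 1)) : CubeIn X q :=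
  ⟨Q.1.faceA (Q.1.dir Q.2.1 i), Q.1.dim_faceA Q.2.1 i, (Q.1.faceA_subset _).trans Q.2.2⟩

/-- The face `B_{j_i} Q` for the `i`-th nondegenerate index `j_i`. -/
def faceB (Q : CubeIn X (q + 1)) (i : Fin (q + 1)) : CubeIn X q :=
  ⟨Q.1.faceB (Q.1.dir Q.2.1 i), Q.1.dim_faceB Q.2.1 i, (Q.1.faceB_subset _).trans Q.2.2⟩

/-- The boundary of a cube, `∑_{i=1}^{q+1} (-1)^i (A_{j_i} Q - B_{j_i} Q)`. The index `i` runs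
over `0, …, q` here, hence the exponent `i + 1`. -/
def boundary (Q : CubeIn X (q + 1)) : Chain X q :=
  ∑ i : Fin (q + 1),
    (-1 : ℤ) ^ ((i : ℕ) + 1) • (Finsupp.single (Q.faceA i) 1 - Finsupp.single (Q.faceB i) 1)

theorem dir_faceA (Q : CubeIn X (q + 1)) (i : Fin (q + 1)) (j : Fin q) :
    (Q.faceA i).1.dir (Q.faceA i).2.1 j = Q.1.dir Q.2.1 (i.succAbove j) :=
  Q.1.dir_of_nondeg_eq _ Q.2.1 i _ (Q.1.nondeg_faceA _) j

theorem dir_faceB (Q : CubeIn X (q + 1)) (i : Fin (q + 1)) (j : Fin q) :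
    (Q.faceB i).1.dir (Q.faceB i).2.1 j = Q.1.dir Q.2.1 (i.succAbove j) :=
  Q.1.dir_of_nondeg_eq _ Q.2.1 i _ (Q.1.nondeg_faceB _) j

end CubeIn

section Complex

variable {n : ℕ} (X : Set (Fin n → ℤ))

/-- The boundary operator `∂_{q+1} : C_{q+1}(X) → C_q(X)`. -/
def boundary (q : ℕ) : Chain X (q + 1) →ₗ[ℤ] Chain X q :=
  Finsupp.linearCombination ℤ CubeIn.boundary

theorem boundary_single {q : ℕ} (Q : CubeIn X (q + 1)) :
    boundary X q (Finsupp.single Q 1) = Q.boundary := by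
  simp [boundary]

theorem boundary_boundary (q : ℕ) : boundary X q ∘ₗ boundary X (q + 1) = 0 := by
  refine Finsupp.lhom_ext' fun Q => LinearMap.ext_ring ?_
  simp only [LinearMap.comp_apply, Finsupp.lsingle_apply, boundary_single, LinearMap.zero_apply]
  have key : boundary X q Q.boundary =
      ∑ p : Fin (q + 2) × Fin (q + 1), (-1 : ℤ) ^ ((p.1 : ℕ) + (p.2 : ℕ)) •
        (Finsupp.single ((Q.faceA p.1).faceA p.2) (1 : ℤ)
          - Finsupp.single ((Q.faceA p.1).faceB p.2) 1
          - Finsupp.single ((Q.faceB p.1).faceA p.2) 1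
          + Finsupp.single ((Q.faceB p.1).faceB p.2) 1) := by
    rw [Fintype.sum_prod_type]
    simp only [CubeIn.boundary, map_sum, map_smul, map_sub, boundary_single,
      ← Finset.sum_sub_distrib, Finset.smul_sum]
    refine Finset.sum_congr rfl fun i _ => Finset.sum_congr rfl fun j _ => ?_
    rw [← smul_sub, smul_smul]
    congr 1
    · ring
    · abel
  rw [key]
  refine Finset.sum_involution
    (fun p _ => (p.1.succAbove p.2, p.2.predAbove p.1)) ?_ ?_ ?_ ?_
  · rintro ⟨i, j⟩ -
    have hne : Q.1.dir Q.2.1 i ≠ Q.1.dir Q.2.1 (i.succAbove j) :=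
      fun e => i.succAbove_ne j ((Q.1.dir Q.2.1).injective e).symm
    have hs := Fin.succAbove_succAbove_predAbove i j
    have e1 : (Q.faceA (i.succAbove j)).faceA (j.predAbove i) = (Q.faceA i).faceA j := by
      apply Subtype.ext
      change (Q.1.faceA _).faceA ((Q.faceA _).1.dir _ _) =
        (Q.1.faceA _).faceA ((Q.faceA _).1.dir _ _)
      rw [CubeIn.dir_faceA, CubeIn.dir_faceA, hs, ElemCube.faceA_faceA]
    have e2 : (Q.faceA (i.succAbove j)).faceB (j.predAbove i) = (Q.faceB i).faceA j := by
      apply Subtype.ext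
      change (Q.1.faceA _).faceB ((Q.faceA _).1.dir _ _) =
        (Q.1.faceB _).faceA ((Q.faceB _).1.dir _ _)
      rw [CubeIn.dir_faceA, CubeIn.dir_faceB, hs, ElemCube.faceA_faceB _ hne.symm]
    have e3 : (Q.faceB (i.succAbove j)).faceA (j.predAbove i) = (Q.faceA i).faceB j := by
      apply Subtype.ext
      change (Q.1.faceB _).faceA ((Q.faceB _).1.dir _ _) =
        (Q.1.faceA _).faceB ((Q.faceA _).1.dir _ _)
      rw [CubeIn.dir_faceA, CubeIn.dir_faceB, hs, ElemCube.faceA_faceB _ hne]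
    have e4 : (Q.faceB (i.succAbove j)).faceB (j.predAbove i) = (Q.faceB i).faceB j := by
      apply Subtype.ext
      change (Q.1.faceB _).faceB ((Q.faceB _).1.dir _ _) =
        (Q.1.faceB _).faceB ((Q.faceB _).1.dir _ _)
      rw [CubeIn.dir_faceB, CubeIn.dir_faceB, hs, ElemCube.faceB_faceB]
    simp only [e1, e2, e3, e4, Fin.neg_one_pow_succAbove_add_predAbove, neg_smul]
    rw [← sub_eq_add_neg, ← smul_sub]
    convert smul_zero _ using 2
    abel
  · rintro ⟨i, j⟩ - - h
    exact i.succAbove_ne j (congrArg Prod.fst h)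
  · intros
    exact Finset.mem_univ _
  · rintro ⟨i, j⟩ -
    simp only [Prod.mk.injEq]
    exact ⟨Fin.succAbove_succAbove_predAbove i j, Fin.predAbove_predAbove_succAbove i j⟩

/-- The `c_1`-cubical chain complex of `X`, as a chain complex of abelian groups. -/
def c1Complex : ChainComplex (ModuleCat.{0} ℤ) ℕ :=
  ChainComplex.of (fun q => ModuleCat.of ℤ (Chain X q))
    (fun q => ModuleCat.ofHom (boundary X q))
    (fun q => by
      rw [← ModuleCat.ofHom_comp, boundary_boundary]
      rfl)

end Complex

/-! ### The induced homomorphism -/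

section Induced

variable {n m : ℕ} {X : Set (Fin n → ℤ)} {Y : Set (Fin m → ℤ)}

/-- The set `f(Q)`, as a subset of `ℤ^m`. -/
def imageSet (f : X → Y) {q : ℕ} (Q : CubeIn X q) : Set (Fin m → ℤ) :=
  {y | ∃ x : X, (x : Fin n → ℤ) ∈ Q.1.toSet ∧ (f x : Fin m → ℤ) = y}

/-- `f` is an embedding on the `q`-cube `Q` when `f(Q)` is an elementary `q`-cube in `Y`. -/
def IsEmbeddingOn (f : X → Y) {q : ℕ} (Q : CubeIn X q) : Prop :=
  ∃ R : CubeIn Y q, imageSet f Q = R.1.toSet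

/-- The cube `f(Q)`, when `f` is an embedding on `Q`. -/
def imageCube (f : X → Y) {q : ℕ} (Q : CubeIn X q) (h : IsEmbeddingOn f Q) : CubeIn Y q :=
  h.choose

theorem imageCube_toSet (f : X → Y) {q : ℕ} (Q : CubeIn X q) (h : IsEmbeddingOn f Q) :
    (imageCube f Q h).1.toSet = imageSet f Q :=
  h.choose_spec.symm

/-- The matrix of the linear part of the affine map describing `f : Q → R`, for `q`-cubes
`Q ⊆ X` and `R ⊆ Y`, where `Q` and `R` are identified with `[0,1]^q` by means of their
nondegenerate coordinates in increasing order. Its `b`-th column is `f(v + e_b) - f(v)`, where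
`v` is the minimal vertex of `Q` and `e_b` the unit vector of the `b`-th nondegenerate
coordinate of `Q`. -/
def linearPart (f : X → Y) {q : ℕ} (Q : CubeIn X q) (R : CubeIn Y q) :
    Matrix (Fin q) (Fin q) ℤ :=
  Matrix.of fun a b =>
    (f ⟨Q.1.vertex (Q.1.dir Q.2.1 b), Q.2.2 (Q.1.vertex_mem _)⟩ : Fin m → ℤ) (R.1.dir R.2.1 a)
      - (f ⟨Q.1.lo, Q.2.2 Q.1.lo_mem⟩ : Fin m → ℤ) (R.1.dir R.2.1 a)

open scoped Classical in
/-- The coefficient `ε_{f,Q}`: the determinant of the affine map `f : Q → f(Q)` if `f` is an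
embedding on `Q`, and `0` otherwise. -/
def orientation (f : X → Y) {q : ℕ} (Q : CubeIn X q) : ℤ :=
  if h : IsEmbeddingOn f Q then (linearPart f Q (imageCube f Q h)).det else 0

open scoped Classical in
/-- The chain `ε_{f,Q} f(Q)`. -/
def mapCube (f : X → Y) {q : ℕ} (Q : CubeIn X q) : Chain Y q :=
  if h : IsEmbeddingOn f Q then
    orientation f Q • Finsupp.single (imageCube f Q h) (1 : ℤ)
  else 0

/-- The induced homomorphism `f_# : C_q(X) → C_q(Y)`, the linear extension of `mapCube f`. -/
def inducedMap (f : X → Y) (q : ℕ) : Chain X q →ₗ[ℤ] Chain Y q :=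
  Finsupp.linearCombination ℤ (mapCube f)

end Induced

end DigitalImage

end

/-!
A continuous function on a `q`-cube is studied as a map `ψ : {0,1}^q → ℤ^m` that moves neighbouring
vertices to equal or adjacent points. The coefficient of a `q`-cube `R` in `f_#(Q)` is the
determinant of the edge vectors of `ψ` if `ψ` has image `R`, and zero otherwise (`mapCube_apply`),
so the theorem is an identity between the contributions of the facets of a `(q+1)`-cube, one
identity for each `R`.

An injective `ψ` maps squares to parallelograms (`IsCubeMap.flip_sub_flip`), hence is affine with
edge vectors `±e_d` along different axes. If `f` embeds the `(q+1)`-cube, its linear part is thus a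
signed permutation matrix, and Laplace expansion along a column compares the orientations of the
cube and of its facets (`sum_facetTerm_eq_of_range_eq`).

If `f` does not embed the `(q+1)`-cube, the contributions of the facets with a given image `R` must
cancel (`sum_facetTerm_eq_zero`). Two such facets in different directions cancel, because the two
edges leaving their intersection are identified by `f` (`flip_eq_flip_of_range_eq`,
`det_edgeMatrix_facet_of_range_eq`). These facets point in at most two directions, and if in two,
then opposite ones occur simultaneously. There remains a facet `ψ` such that no facet in another
direction has image `R`; the opposite facet `ψ'` is then pointwise near to `ψ`. Label a vertex by the
direction in which `ψ'` moves it inside the cube `R`. Labels of neighbours are compatible by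
`IsStep.edge_rule`, and no facet of `ψ` is moved as a whole onto the opposite one. In dimension
`q ≤ 3`, where the hypothesis `n ≤ 4` enters, this leaves only the empty labelling and the quarter
turns (`exists_rotation_of_labelling`), so that `ψ'` is equal to `ψ`, a quarter turn of `ψ`, or a
transverse translate of `ψ`. The last case is an embedding of the `(q+1)`-cube, and in the other two
the opposite facet cancels the given one.
-/

namespace DigitalImage

/-! ### Unit steps in `ℤ^m` -/

/-- A vector `±e_d` of `ℤ^m`. -/
def IsStep {m : ℕ} (v : Fin m → ℤ) : Prop :=
  ∃ d s, (s = 1 ∨ s = -1) ∧ v = Pi.single d s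

/-- The possible differences of two points of `ℤ^m` that are `c_1`-adjacent or equal. -/
def IsNear {m : ℕ} (v : Fin m → ℤ) : Prop := v = 0 ∨ IsStep v

section Steps

variable {m : ℕ} {u v p p' : Fin m → ℤ}

theorem IsStep.eq_single (h : IsStep v) {d : Fin m} (hd : v d ≠ 0) : v = Pi.single d (v d) := by
  obtain ⟨e, s, -, rfl⟩ := h
  obtain rfl : d = e := by
    by_contra hne
    exact hd (Pi.single_eq_of_ne hne _)
  simp

theorem IsStep.apply_cases (h : IsStep v) (d : Fin m) : v d = 0 ∨ v d = 1 ∨ v d = -1 := by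
  obtain ⟨e, s, hs, rfl⟩ := h
  by_cases hd : d = e
  · subst hd; simp only [Pi.single_eq_same]; exact Or.inr hs
  · simp [hd]

theorem IsStep.exists_ne (h : IsStep v) : ∃ d, v d ≠ 0 := by
  obtain ⟨d, s, hs, rfl⟩ := h
  refine ⟨d, ?_⟩
  rcases hs with rfl | rfl <;> simp

theorem IsStep.ne_zero (h : IsStep v) : v ≠ 0 := by
  rintro rfl
  obtain ⟨d, hd⟩ := h.exists_ne
  exact hd rfl

theorem IsStep.odd_sum (h : IsStep v) : Odd (∑ i, v i) := by
  obtain ⟨d, s, hs, rfl⟩ := h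
  rw [Finset.sum_pi_single']
  rcases hs with rfl | rfl <;> simp

theorem IsNear.eq_single (h : IsNear v) {d : Fin m} (hd : v d ≠ 0) : v = Pi.single d (v d) := by
  rcases h with rfl | h
  · exact absurd rfl hd
  · exact h.eq_single hd

theorem IsNear.eq_zero_of_even (h : IsNear v) (hv : Even (∑ i, v i)) : v = 0 := by
  rcases h with h | h
  · exact h
  · exact absurd hv (Int.not_even_iff_odd.2 h.odd_sum)

theorem IsNear.isStep_of_odd (h : IsNear v) (hv : Odd (∑ i, v i)) : IsStep v := by
  rcases h with rfl | h
  · simp at hv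
  · exact h

theorem IsStep.eq_or_eq_neg (hu : IsStep u) (hv : IsStep v) {d : Fin m} (h1 : u d ≠ 0)
    (h2 : v d ≠ 0) : v = u ∨ v = -u := by
  rw [hu.eq_single h1, hv.eq_single h2, ← Pi.single_neg]
  rcases hu.apply_cases d with h | h | h <;> rcases hv.apply_cases d with h' | h' | h' <;>
    simp_all

/-- A vector that is a sum of two steps without cancellation determines the steps up to order. -/
theorem IsStep.add_eq_add (hu : IsStep u) (hv : IsStep v) (hp : IsStep p) (hp' : IsStep p')
    (h : u + p = v + p') : u = v ∨ u = p' ∨ u + p = 0 := by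
  obtain ⟨d, hd⟩ := hu.exists_ne
  have hsum := congrFun h d
  simp only [Pi.add_apply] at hsum
  have hu' := hu.apply_cases d
  have hcv := hv.apply_cases d
  have hcp := hp.apply_cases d
  have hcp' := hp'.apply_cases d
  by_cases h1 : v d = u d
  · left
    rw [hu.eq_single hd, hv.eq_single (h1 ▸ hd), h1]
  by_cases h2 : p' d = u d
  · right; left
    rw [hu.eq_single hd, hp'.eq_single (h2 ▸ hd), h2]
  right; right
  have h3 : p d = -u d := by omega
  rw [hu.eq_single hd, hp.eq_single (by omega : p d ≠ 0), h3, Pi.single_neg, add_neg_cancel]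

/-- Two near points `x`, `y` with `y - x = w` are moved by `u` and `v` to near points only if they
are moved in parallel, or one of them is moved onto the other. -/
theorem IsStep.edge_rule {w : Fin m → ℤ} (hw : IsStep w) (hu : IsNear u) (hv : IsNear v)
    (h : IsNear (w + v - u)) : u = v ∨ u = w ∨ v = -w := by
  have hwodd := hw.odd_sum
  have hsum : ∑ i, (w + v - u) i = ∑ i, w i + ∑ i, v i - ∑ i, u i := by
    simp [Finset.sum_add_distrib]
  rcases hu with rfl | hu <;> rcases hv with rfl | hv
  · exact Or.inl rfl
  · right; right
    have := h.eq_zero_of_even (by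
      rw [hsum]; simpa using hwodd.add_odd hv.odd_sum)
    rw [sub_zero] at this
    exact (neg_eq_of_add_eq_zero_right this).symm
  · right; left
    have := h.eq_zero_of_even (by
      rw [hsum]; simpa using hwodd.sub_odd hu.odd_sum)
    rw [add_zero] at this
    exact (sub_eq_zero.1 this).symm
  · have hs := h.isStep_of_odd (by
      rw [hsum]; exact (hwodd.add_odd hv.odd_sum).sub_odd hu.odd_sum)
    rcases hw.add_eq_add hu hv hs (by abel) with h1 | h1 | h1
    · exact Or.inr (Or.inl h1.symm)
    · left
      have : v - u = 0 := by
        have : w = w + (v - u) := by rw [← add_sub_assoc]; exact h1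
        simpa using this
      exact (sub_eq_zero.1 this).symm
    · exact Or.inr (Or.inr (neg_eq_of_add_eq_zero_right h1).symm)

end Steps

/-! ### Maps on the discrete cube -/

section Cube

variable {q m : ℕ}

/-- The neighbour of the vertex `s` of `{0,1}^q` in the `k`-th direction. -/
def flip (s : Fin q → Bool) (k : Fin q) : Fin q → Bool := Function.update s k (!s k)

@[simp] theorem flip_same (s : Fin q → Bool) (k : Fin q) : flip s k k = !s k := by simp [flip]

theorem flip_of_ne (s : Fin q → Bool) {k j : Fin q} (h : j ≠ k) : flip s k j = s j := by
  simp [flip, h]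

@[simp] theorem flip_flip (s : Fin q → Bool) (k : Fin q) : flip (flip s k) k = s := by
  simp [flip]

theorem flip_comm (s : Fin q → Bool) (k j : Fin q) :
    flip (flip s k) j = flip (flip s j) k := by
  ext i
  by_cases h1 : i = k <;> by_cases h2 : i = j <;> simp [flip, Function.update_apply] <;> grind

theorem flip_ne (s : Fin q → Bool) (k : Fin q) : flip s k ≠ s := fun h => by
  simpa using congrFun h k

theorem flip_injective (s : Fin q → Bool) : Function.Injective (flip s) := by
  intro k j h
  by_contra hne
  have := congrFun h k
  rw [flip_same, flip_of_ne s hne] at this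
  simp at this

/-- A function on `{0,1}^q` that takes the same value at neighbouring vertices is constant. -/
theorem eq_of_flip_eq {α : Type*} (G : (Fin q → Bool) → α) (h : ∀ s k, G (flip s k) = G s)
    (s t : Fin q → Bool) : G s = G t := by
  have key : ∀ A : Finset (Fin q), G (A.piecewise t s) = G s := by
    intro A
    induction A using Finset.induction_on with
    | empty => simp
    | insert k A _ ih =>
      rw [Finset.piecewise_insert, ← ih]
      by_cases hk : t k = A.piecewise t s k
      · rw [hk, Function.update_eq_self]
      · rw [← h _ k, flip]
        congr 2
        cases h1 : t k <;> cases h2 : A.piecewise t s k <;> simp_all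
  simpa using (key Finset.univ).symm

/-- A map `{0,1}^q → ℤ^m` that sends neighbouring vertices to `c_1`-adjacent or equal points. -/
def IsCubeMap (ψ : (Fin q → Bool) → Fin m → ℤ) : Prop :=
  ∀ s k, IsNear (ψ (flip s k) - ψ s)

/-- The sign `(-1)^c`. -/
def bsign (c : Bool) : ℤ := if c then -1 else 1

@[simp] theorem bsign_false : bsign false = 1 := rfl

@[simp] theorem bsign_true : bsign true = -1 := rfl

theorem bsign_not (c : Bool) : bsign (!c) = -bsign c := by cases c <;> simp

theorem bsign_mul_self (c : Bool) : bsign c * bsign c = 1 := by cases c <;> simp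

/-- The minimal vertex of `{0,1}^q`. -/
def origin (q : ℕ) : Fin q → Bool := fun _ => false

/-- The edge vector of `ψ` at the origin in the `k`-th direction. -/
def edge (ψ : (Fin q → Bool) → Fin m → ℤ) (k : Fin q) : Fin m → ℤ :=
  ψ (flip (origin q) k) - ψ (origin q)

namespace IsCubeMap

variable {ψ : (Fin q → Bool) → Fin m → ℤ}

theorem isStep (hψ : IsCubeMap ψ) (hi : Function.Injective ψ) (s : Fin q → Bool) (k : Fin q) :
    IsStep (ψ (flip s k) - ψ s) :=
  (hψ s k).resolve_left fun h => flip_ne s k (hi (sub_eq_zero.1 h))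

/-- An injective cube map sends squares to parallelograms. -/
theorem flip_sub_flip (hψ : IsCubeMap ψ) (hi : Function.Injective ψ) (s : Fin q → Bool)
    {k j : Fin q} (hkj : k ≠ j) :
    ψ (flip (flip s j) k) - ψ (flip s j) = ψ (flip s k) - ψ s := by
  have hne : ψ (flip s k) - ψ s ≠ ψ (flip s j) - ψ s := fun h =>
    hkj (flip_injective s (hi (sub_left_injective h)))
  have h2 := hψ.isStep hi (flip s k) j
  rw [flip_comm] at h2
  rcases (hψ.isStep hi s k).add_eq_add (hψ.isStep hi s j) h2 (hψ.isStep hi (flip s j) k)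
    (by abel) with h | h | h
  · exact absurd h hne
  · exact h.symm
  · have h3 : flip (flip s j) k = s := hi (by rw [← sub_eq_zero, ← h]; abel)
    have := congrFun h3 k
    rw [flip_same, flip_of_ne s hkj] at this
    simp at this

/-- The edge vectors of an injective cube map do not depend on the base vertex, up to the sign
given by the direction in which the edge is run through. -/
theorem flip_eq (hψ : IsCubeMap ψ) (hi : Function.Injective ψ) (s : Fin q → Bool) (k : Fin q) :
    ψ (flip s k) = ψ s + bsign (s k) • edge ψ k := by
  have key := eq_of_flip_eq (fun s => bsign (s k) • (ψ (flip s k) - ψ s)) (fun s j => by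
    by_cases h : k = j
    · subst h
      rw [flip_same, flip_flip, bsign_not, neg_smul, ← smul_neg, neg_sub]
    · rw [hψ.flip_sub_flip hi s h, flip_of_ne s h]) s (origin q)
  rw [show origin q k = false from rfl, bsign_false, one_smul] at key
  rw [edge, ← key, smul_smul, bsign_mul_self, one_smul, add_sub_cancel]

theorem isStep_edge (hψ : IsCubeMap ψ) (hi : Function.Injective ψ) (k : Fin q) :
    IsStep (edge ψ k) := hψ.isStep hi _ _

/-- The edge vectors of an injective cube map point along different axes. -/
theorem edge_apply_eq_zero (hψ : IsCubeMap ψ) (hi : Function.Injective ψ) {k j : Fin q}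
    (hkj : k ≠ j) {d : Fin m} (hd : edge ψ k d ≠ 0) : edge ψ j d = 0 := by
  by_contra hd'
  rcases (hψ.isStep_edge hi k).eq_or_eq_neg (hψ.isStep_edge hi j) hd hd' with h | h
  · exact hkj (flip_injective _ (hi (sub_left_injective h))).symm
  · have h1 := hψ.flip_eq hi (flip (origin q) k) j
    rw [hψ.flip_eq hi _ k, flip_of_ne _ hkj.symm, h] at h1
    have h2 : flip (flip (origin q) k) j = origin q := hi (by rw [h1]; simp [origin])
    have := congrFun h2 j
    rw [flip_same, flip_of_ne _ hkj.symm] at this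
    simp at this

/-- The coordinate of `ψ s` along the axis of the `k`-th edge vector depends on `s k` alone. -/
theorem apply_eq (hψ : IsCubeMap ψ) (hi : Function.Injective ψ) {k : Fin q} {d : Fin m}
    (hd : edge ψ k d ≠ 0) (s : Fin q → Bool) :
    ψ s d = ψ (origin q) d + if s k then edge ψ k d else 0 := by
  have key := eq_of_flip_eq (fun s => ψ s d - if s k then edge ψ k d else 0) (fun s j => by
    rw [hψ.flip_eq hi s j, Pi.add_apply, Pi.smul_apply]
    by_cases h : k = j
    · subst h
      rw [flip_same]
      cases s k <;> simp [sub_eq_add_neg]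
    · rw [flip_of_ne s h, hψ.edge_apply_eq_zero hi h hd]
      simp) s (origin q)
  simp only [origin, Bool.false_eq_true, if_false, sub_zero] at key
  rw [← sub_eq_iff_eq_add]
  exact key

/-- A coordinate transverse to all edge vectors is constant. -/
theorem apply_eq_of_edge_eq_zero (hψ : IsCubeMap ψ) (hi : Function.Injective ψ) {d : Fin m}
    (hd : ∀ k, edge ψ k d = 0) (s t : Fin q → Bool) : ψ s d = ψ t d :=
  eq_of_flip_eq (fun s => ψ s d) (fun s j => by
    rw [hψ.flip_eq hi s j, Pi.add_apply, Pi.smul_apply, hd]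
    simp) s t

end IsCubeMap

end Cube

/-! ### Labellings of cubes of dimension at most three -/

section Labelling

/-- The compatibility of the labels `a` and `b` of two neighbouring vertices in direction `k`. -/
def Compat {q : ℕ} (k : Fin q) (a b : Option (Fin q)) : Prop :=
  a = b ∨ a = some k ∨ b = some k

instance {q : ℕ} (k : Fin q) (a b : Option (Fin q)) : Decidable (Compat k a b) :=
  inferInstanceAs (Decidable (_ ∨ _ ∨ _))

/-- The labellings of a square. Each constraint is stated as soon as the labels that it involves
have been introduced, which keeps the case distinction small. -/
theorem labelling_two : ∀ a00 a10 : Option (Fin 2), Compat 0 a00 a10 →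
    ∀ a01, Compat 1 a00 a01 → ¬ (a00 = some 0 ∧ a01 = some 0) →
    ¬ (a00 = some 1 ∧ a10 = some 1) →
    ∀ a11, Compat 0 a01 a11 → Compat 1 a10 a11 → ¬ (a10 = some 0 ∧ a11 = some 0) →
    ¬ (a01 = some 1 ∧ a11 = some 1) →
    (a00 = none ∧ a10 = none ∧ a01 = none ∧ a11 = none) ∨
    ∃ i j : Fin 2, i ≠ j ∧ ∀ x y : Bool,
      (bif x then (bif y then a11 else a10) else (bif y then a01 else a00))
      = some (if ![x, y] i = ![x, y] j then i else j) := by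
  decide

set_option synthInstance.maxHeartbeats 400000 in
set_option synthInstance.maxSize 2000 in
set_option maxRecDepth 100000 in
/-- The labellings of a three-dimensional cube, with the constraints ordered as for the square. -/
theorem labelling_three : ∀ a000 a100 : Option (Fin 3), Compat 0 a000 a100 →
    ∀ a010, Compat 1 a000 a010 →
    ∀ a110, Compat 0 a010 a110 → Compat 1 a100 a110 →
    ¬ (a000 = some 2 ∧ a100 = some 2 ∧ a010 = some 2 ∧ a110 = some 2) →
    ∀ a001, Compat 2 a000 a001 →
    ∀ a101, Compat 0 a001 a101 → Compat 2 a100 a101 →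
    ¬ (a000 = some 1 ∧ a100 = some 1 ∧ a001 = some 1 ∧ a101 = some 1) →
    ∀ a011, Compat 1 a001 a011 → Compat 2 a010 a011 →
    ¬ (a000 = some 0 ∧ a010 = some 0 ∧ a001 = some 0 ∧ a011 = some 0) →
    ∀ a111, Compat 0 a011 a111 → Compat 1 a101 a111 → Compat 2 a110 a111 →
    ¬ (a001 = some 2 ∧ a101 = some 2 ∧ a011 = some 2 ∧ a111 = some 2) →
    ¬ (a010 = some 1 ∧ a110 = some 1 ∧ a011 = some 1 ∧ a111 = some 1) →
    ¬ (a100 = some 0 ∧ a110 = some 0 ∧ a101 = some 0 ∧ a111 = some 0) →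
    (a000 = none ∧ a100 = none ∧ a010 = none ∧ a110 = none ∧
      a001 = none ∧ a101 = none ∧ a011 = none ∧ a111 = none) ∨
    ∃ i j : Fin 3, i ≠ j ∧ ∀ x y z : Bool,
      (bif x then (bif y then (bif z then a111 else a110) else (bif z then a101 else a100))
        else (bif y then (bif z then a011 else a010) else (bif z then a001 else a000)))
      = some (if ![x, y, z] i = ![x, y, z] j then i else j) := by
  decide

theorem exists_rotation_of_labelling_two (L : (Fin 2 → Bool) → Option (Fin 2))
    (hL : ∀ s k, Compat k (L s) (L (flip s k))) (hf : ∀ k c, ∃ s, s k = c ∧ L s ≠ some k) :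
    (∀ s, L s = none) ∨
      ∃ i j, i ≠ j ∧ ∀ s, L s = some (if s i = s j then i else j) := by
  have e : ∀ s : Fin 2 → Bool, s = ![s 0, s 1] := fun s => by
    ext i; fin_cases i <;> rfl
  have f0 : ∀ x y, flip ![x, y] 0 = ![!x, y] := by decide
  have f1 : ∀ x y, flip ![x, y] 1 = ![x, !y] := by decide
  have h0 : ∀ x y, Compat 0 (L ![x, y]) (L ![!x, y]) := fun x y => f0 x y ▸ hL _ _
  have h1 : ∀ x y, Compat 1 (L ![x, y]) (L ![x, !y]) := fun x y => f1 x y ▸ hL _ _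
  have g0 : ∀ c, ¬ (L ![c, false] = some 0 ∧ L ![c, true] = some 0) := fun c h => by
    obtain ⟨s, rfl, h'⟩ := hf 0 c
    rw [e s] at h'
    clear * - h h'
    cases h1 : s 1 <;> simp_all
  have g1 : ∀ c, ¬ (L ![false, c] = some 1 ∧ L ![true, c] = some 1) := fun c h => by
    obtain ⟨s, rfl, h'⟩ := hf 1 c
    rw [e s] at h'
    clear * - h h'
    cases h1 : s 0 <;> simp_all
  rcases labelling_two _ _ (h0 false false) _ (h1 false false) (g0 _) (g1 _) _ (h0 false true)
    (h1 true false) (g0 _) (g1 _) with h | ⟨i, j, hij, h⟩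
  · left
    intro s
    rw [e s]
    clear * - h
    cases s 0 <;> cases s 1 <;> simp_all
  · right
    refine ⟨i, j, hij, fun s => ?_⟩
    have := h (s 0) (s 1)
    rw [← e s] at this
    rw [← this]
    conv_lhs => rw [e s]
    cases s 0 <;> cases s 1 <;> rfl

theorem exists_rotation_of_labelling_three (L : (Fin 3 → Bool) → Option (Fin 3))
    (hL : ∀ s k, Compat k (L s) (L (flip s k))) (hf : ∀ k c, ∃ s, s k = c ∧ L s ≠ some k) :
    (∀ s, L s = none) ∨
      ∃ i j, i ≠ j ∧ ∀ s, L s = some (if s i = s j then i else j) := by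
  have e : ∀ s : Fin 3 → Bool, s = ![s 0, s 1, s 2] := fun s => by
    ext i; fin_cases i <;> rfl
  have f0 : ∀ x y z, flip ![x, y, z] 0 = ![!x, y, z] := by decide
  have f1 : ∀ x y z, flip ![x, y, z] 1 = ![x, !y, z] := by decide
  have f2 : ∀ x y z, flip ![x, y, z] 2 = ![x, y, !z] := by decide
  have h0 : ∀ x y z, Compat 0 (L ![x, y, z]) (L ![!x, y, z]) := fun x y z => f0 x y z ▸ hL _ _
  have h1 : ∀ x y z, Compat 1 (L ![x, y, z]) (L ![x, !y, z]) := fun x y z => f1 x y z ▸ hL _ _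
  have h2 : ∀ x y z, Compat 2 (L ![x, y, z]) (L ![x, y, !z]) := fun x y z => f2 x y z ▸ hL _ _
  have g0 : ∀ c, ¬ (L ![c, false, false] = some 0 ∧ L ![c, true, false] = some 0 ∧
      L ![c, false, true] = some 0 ∧ L ![c, true, true] = some 0) := fun c h => by
    obtain ⟨s, rfl, h'⟩ := hf 0 c
    rw [e s] at h'
    clear * - h h'
    cases h1 : s 1 <;> cases h2 : s 2 <;> simp_all
  have g1 : ∀ c, ¬ (L ![false, c, false] = some 1 ∧ L ![true, c, false] = some 1 ∧
      L ![false, c, true] = some 1 ∧ L ![true, c, true] = some 1) := fun c h => by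
    obtain ⟨s, rfl, h'⟩ := hf 1 c
    rw [e s] at h'
    clear * - h h'
    cases h1 : s 0 <;> cases h2 : s 2 <;> simp_all
  have g2 : ∀ c, ¬ (L ![false, false, c] = some 2 ∧ L ![true, false, c] = some 2 ∧
      L ![false, true, c] = some 2 ∧ L ![true, true, c] = some 2) := fun c h => by
    obtain ⟨s, rfl, h'⟩ := hf 2 c
    rw [e s] at h'
    clear * - h h'
    cases h1 : s 0 <;> cases h2 : s 1 <;> simp_all
  rcases labelling_three _ _ (h0 false false false) _ (h1 false false false) _
    (h0 false true false) (h1 true false false) (g2 _) _ (h2 false false false) _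
    (h0 false false true) (h2 true false false) (g1 _) _ (h1 false false true)
    (h2 false true false) (g0 _) _ (h0 false true true) (h1 true false true)
    (h2 true true false) (g2 _) (g1 _) (g0 _) with h | ⟨i, j, hij, h⟩
  · left
    intro s
    rw [e s]
    clear * - h
    cases s 0 <;> cases s 1 <;> cases s 2 <;> simp_all
  · right
    refine ⟨i, j, hij, fun s => ?_⟩
    have := h (s 0) (s 1) (s 2)
    rw [← e s] at this
    rw [← this]
    conv_lhs => rw [e s]
    cases s 0 <;> cases s 1 <;> cases s 2 <;> rfl

/-- A labelling of the vertices of a cube of dimension at most three by directions, with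
compatible labels along each edge and without a facet transverse to `k` all of whose labels are
`k`, is empty or describes the rotation by a right angle in a coordinate plane. -/
theorem exists_rotation_of_labelling {q : ℕ} (hq : q ≤ 3) (L : (Fin q → Bool) → Option (Fin q))
    (hL : ∀ s k, Compat k (L s) (L (flip s k))) (hf : ∀ k c, ∃ s, s k = c ∧ L s ≠ some k) :
    (∀ s, L s = none) ∨
      ∃ i j, i ≠ j ∧ ∀ s, L s = some (if s i = s j then i else j) := by
  interval_cases q
  · exact Or.inl fun s => Option.eq_none_iff_forall_ne_some.2 fun k => k.elim0
  · left
    intro s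
    refine Option.eq_none_iff_forall_ne_some.2 fun k => ?_
    obtain ⟨t, ht, h⟩ := hf k (s k)
    obtain rfl : t = s := by ext i; rwa [Subsingleton.elim i k]
    exact h
  · exact exists_rotation_of_labelling_two L hL hf
  · exact exists_rotation_of_labelling_three L hL hf

end Labelling

/-! ### Two neighbouring copies of a cube -/

section Opposite

variable {q m : ℕ}

/-- The possible positions of a cube map `ψ'` that is pointwise near to an injective cube map
`ψ` on a cube of dimension at most three: `ψ'` moves a whole facet of `ψ` onto the opposite facet,
or equals `ψ`, or is a quarter turn of `ψ`, or is a translate of `ψ` in a transverse direction. -/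
theorem IsCubeMap.cases_of_near (hq : q ≤ 3) {ψ ψ' : (Fin q → Bool) → Fin m → ℤ}
    (hψ : IsCubeMap ψ) (hi : Function.Injective ψ) (hψ' : IsCubeMap ψ')
    (hn : ∀ s, IsNear (ψ' s - ψ s)) :
    (∃ j c, ∀ s, s j = c → ψ' s = ψ (flip s j)) ∨ ψ' = ψ ∨
      (∃ i j, i ≠ j ∧ ∀ s, ψ' s = ψ (flip s (if s i = s j then i else j))) ∨
      ∃ v, IsStep v ∧ (∀ k d, v d ≠ 0 → edge ψ k d = 0) ∧ ∀ s, ψ' s = ψ s + v := by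
  classical
  by_cases hfacet : ∃ j c, ∀ s, s j = c → ψ' s = ψ (flip s j)
  · exact Or.inl hfacet
  right
  push Not at hfacet
  -- The label of `s` is the direction in which `ψ'` moves the vertex `ψ s` inside the cube.
  obtain ⟨L, hL⟩ : ∃ L : (Fin q → Bool) → Option (Fin q),
      ∀ s k, L s = some k ↔ ψ' s = ψ (flip s k) := by
    refine ⟨fun s => if h : ∃ k, ψ' s = ψ (flip s k) then some h.choose else none, fun s k => ?_⟩
    beta_reduce
    by_cases h : ∃ k, ψ' s = ψ (flip s k)
    · rw [dif_pos h, Option.some_inj]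
      refine ⟨fun e => e ▸ h.choose_spec, fun e => ?_⟩
      exact flip_injective s (hi (h.choose_spec.symm.trans e))
    · rw [dif_neg h]
      exact ⟨fun e => by simp at e, fun e => absurd ⟨k, e⟩ h⟩
  have hedge : ∀ s k, ψ' s - ψ s = ψ' (flip s k) - ψ (flip s k) ∨ L s = some k ∨
      L (flip s k) = some k := fun s k => by
    rw [hL, hL, flip_flip]
    rcases (hψ.isStep hi s k).edge_rule (hn s) (hn (flip s k)) (by
      rw [show ψ (flip s k) - ψ s + (ψ' (flip s k) - ψ (flip s k)) - (ψ' s - ψ s)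
        = ψ' (flip s k) - ψ' s by abel]
      exact hψ' s k) with h | h | h
    · exact Or.inl h
    · exact Or.inr (Or.inl (sub_left_injective h))
    · right; right
      rw [neg_sub] at h
      exact sub_left_injective h
  have hcompat : ∀ s k, Compat k (L s) (L (flip s k)) := fun s k => by
    rcases hedge s k with h | h | h
    · by_cases h1 : L s = some k
      · exact Or.inr (Or.inl h1)
      by_cases h2 : L (flip s k) = some k
      · exact Or.inr (Or.inr h2)
      left
      refine Option.ext fun j => ?_
      by_cases hj : j = k
      · subst hj; exact iff_of_false h1 h2
      · have := hψ.flip_sub_flip hi s hj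
        rw [hL, hL, ← sub_left_inj (a := ψ s), h, ← this, sub_left_inj]
    · exact Or.inr (Or.inl h)
    · exact Or.inr (Or.inr h)
  rcases exists_rotation_of_labelling hq L hcompat (fun k c => by
    obtain ⟨s, hs, h⟩ := hfacet k c
    exact ⟨s, hs, fun e => h ((hL s k).1 e)⟩) with h | ⟨i, j, hij, h⟩
  · have hconst : ∀ s, ψ' s - ψ s = ψ' (origin q) - ψ (origin q) := fun s =>
      eq_of_flip_eq (fun s => ψ' s - ψ s) (fun s k => by
        rcases hedge s k with e | e | e
        · exact e.symm
        · simp [h] at e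
        · simp [h] at e) s _
    rcases hn (origin q) with h0 | h0
    · left
      funext s
      rw [← sub_eq_zero, hconst, h0]
    · right; right
      refine ⟨_, h0, fun k d hd => ?_, fun s => by rw [← hconst s]; abel⟩
      by_contra hk
      rcases (hψ.isStep_edge hi k).eq_or_eq_neg h0 hk hd with e | e
      · have := (hL (origin q) k).2 (sub_left_injective e)
        simp [h] at this
      · have e' := hconst (flip (origin q) k)
        rw [e, edge, neg_sub] at e'
        have := (hL (flip (origin q) k) k).2 (by rw [flip_flip]; exact sub_left_injective e')
        simp [h] at this
  · exact Or.inr (Or.inl ⟨i, j, hij, fun s => (hL s _).1 (h s)⟩)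

/-- The matrix of the edge vectors of `ψ` in the coordinates `e`. -/
def edgeMatrix (ψ : (Fin q → Bool) → Fin m → ℤ) (e : Fin q → Fin m) :
    Matrix (Fin q) (Fin q) ℤ :=
  Matrix.of fun a b => edge ψ b (e a)

/-- The alternating flip of the coordinates `i` and `j` turns the vertex `s` by a right angle in
the plane of these coordinates. -/
theorem flip_ite_apply {i j : Fin q} (hij : i ≠ j) (s : Fin q → Bool) (k : Fin q) :
    flip s (if s i = s j then i else j) k =
      if k = i then !s j else if k = j then s i else s k := by
  split_ifs with h1 h2 h3 h2 h3
  · subst h2; simp [h1]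
  · subst h3; simp [flip_of_ne _ h2, h1]
  · simp [flip_of_ne _ h2]
  · subst h2; rw [flip_of_ne _ hij]; cases h4 : s k <;> cases h5 : s j <;> simp_all
  · subst h3; rw [flip_same]; cases h4 : s i <;> cases h5 : s k <;> simp_all
  · simp [flip_of_ne _ h3]

theorem surjective_flip_ite {i j : Fin q} (hij : i ≠ j) :
    Function.Surjective fun s : Fin q → Bool => flip s (if s i = s j then i else j) := by
  apply Finite.surjective_of_injective
  intro s t h
  have h' := fun k => congrFun h k
  simp only [flip_ite_apply hij] at h'
  funext k
  by_cases h1 : k = i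
  · subst h1
    simpa [hij.symm] using h' j
  by_cases h2 : k = j
  · subst h2
    simpa using h' i
  simpa [h1, h2] using h' k

/-- A quarter turn does not change the orientation. -/
theorem det_edgeMatrix_rotation {ψ ψ' : (Fin q → Bool) → Fin m → ℤ} (hψ : IsCubeMap ψ)
    (hi : Function.Injective ψ) {i j : Fin q} (hij : i ≠ j)
    (h : ∀ s, ψ' s = ψ (flip s (if s i = s j then i else j))) (e : Fin q → Fin m) :
    (edgeMatrix ψ' e).det = (edgeMatrix ψ e).det := by
  have h0 : ψ' (origin q) = ψ (flip (origin q) i) := by simp [h, origin]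
  have hM : edgeMatrix ψ' e = Matrix.of fun a b => (if b = j then (-1 : ℤ) else 1) *
      ((edgeMatrix ψ e).submatrix id (Equiv.swap i j)) a b := by
    ext a b
    simp only [edgeMatrix, Matrix.of_apply, Matrix.submatrix_apply, id]
    rw [edge, h0, h]
    by_cases hbi : b = i
    · subst hbi
      rw [if_neg hij, flip_same, flip_of_ne _ hij.symm, if_neg (by simp [origin]),
        Equiv.swap_apply_left, hψ.flip_eq hi _ j, flip_of_ne _ hij.symm]
      simp [origin]
    by_cases hbj : b = j
    · subst hbj
      rw [if_pos rfl, flip_same, flip_of_ne _ hij, if_neg (by simp [origin]), flip_flip,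
        Equiv.swap_apply_right, edge]
      simp
    · rw [if_neg hbj, flip_of_ne _ (Ne.symm hbi), flip_of_ne _ (Ne.symm hbj),
        if_pos (by simp [origin]), flip_comm, hψ.flip_eq hi _ b, flip_of_ne _ hbi, Equiv.swap_apply_of_ne_of_ne hbi hbj]
      simp [origin]
  rw [hM, Matrix.det_mul_row, Matrix.det_permute', Equiv.Perm.sign_swap hij]
  simp

end Opposite

/-! ### Facets of the discrete cube -/

section Facets

variable {q m : ℕ} {φ : (Fin (q + 1) → Bool) → Fin m → ℤ}

/-- The restriction of a map on `{0,1}^(q+1)` to the facet on which the `k`-th coordinate is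
`c`. -/
def facet {α : Type*} (φ : (Fin (q + 1) → Bool) → α) (k : Fin (q + 1)) (c : Bool) :
    (Fin q → Bool) → α :=
  fun s => φ (k.insertNth c s)

theorem flip_insertNth_self (k : Fin (q + 1)) (c : Bool) (s : Fin q → Bool) :
    flip (k.insertNth c s : Fin (q + 1) → Bool) k = k.insertNth (!c) s := by
  ext i
  rcases Fin.eq_self_or_eq_succAbove k i with rfl | ⟨j, rfl⟩
  · simp
  · simp [flip_of_ne]

theorem flip_insertNth_succAbove (k : Fin (q + 1)) (c : Bool) (s : Fin q → Bool) (j : Fin q) :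
    flip (k.insertNth c s : Fin (q + 1) → Bool) (k.succAbove j) = k.insertNth c (flip s j) := by
  ext i
  rcases Fin.eq_self_or_eq_succAbove k i with rfl | ⟨l, rfl⟩
  · simp [flip_of_ne]
  · by_cases h : l = j
    · subst h; simp
    · rw [flip_of_ne _ (fun e => h (Fin.succAbove_right_injective e))]
      simp [flip_of_ne _ h]

theorem exists_insertNth {k : Fin (q + 1)} {c : Bool} {x : Fin (q + 1) → Bool} (h : x k = c) :
    ∃ s : Fin q → Bool, x = k.insertNth c s :=
  ⟨k.removeNth x, by rw [← h, Fin.insertNth_self_removeNth]⟩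

theorem facet_flip (k : Fin (q + 1)) (c : Bool) (s : Fin q → Bool) (j : Fin q) :
    facet φ k c (flip s j) = φ (flip (k.insertNth c s) (k.succAbove j)) := by
  rw [flip_insertNth_succAbove, facet]

theorem IsCubeMap.facet (hφ : IsCubeMap φ) (k : Fin (q + 1)) (c : Bool) :
    IsCubeMap (facet φ k c) := fun s j => by
  rw [facet_flip]; exact hφ _ _

theorem IsCubeMap.near_facet (hφ : IsCubeMap φ) (k : Fin (q + 1)) (c : Bool) (s : Fin q → Bool) :
    IsNear (DigitalImage.facet φ k (!c) s - DigitalImage.facet φ k c s) := by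
  have := hφ (k.insertNth c s) k
  rwa [flip_insertNth_self] at this

theorem eq_of_facet_injective {k : Fin (q + 1)} {c : Bool} (hi : Function.Injective (facet φ k c))
    {x y : Fin (q + 1) → Bool} (hx : x k = c) (hy : y k = c) (h : φ x = φ y) : x = y := by
  obtain ⟨s, rfl⟩ := exists_insertNth hx
  obtain ⟨t, rfl⟩ := exists_insertNth hy
  rw [hi h]

theorem mem_range_facet {k : Fin (q + 1)} {c : Bool} {y : Fin m → ℤ} :
    y ∈ Set.range (facet φ k c) ↔ ∃ x, x k = c ∧ φ x = y :=
  ⟨fun ⟨s, hs⟩ => ⟨_, by simp, hs⟩, fun ⟨x, hx, h⟩ => by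
    obtain ⟨s, rfl⟩ := exists_insertNth hx
    exact ⟨s, h⟩⟩

theorem IsCubeMap.edge_eq {ψ : (Fin q → Bool) → Fin m → ℤ} (hψ : IsCubeMap ψ)
    (hi : Function.Injective ψ) (s : Fin q → Bool) (k : Fin q) :
    edge ψ k = bsign (s k) • (ψ (flip s k) - ψ s) := by
  rw [hψ.flip_eq hi, add_sub_cancel_left, smul_smul, bsign_mul_self, one_smul]

/-- If two facets in different directions are mapped injectively onto the same set, then the two
edges leaving one facet inside the other have the same image. -/
theorem flip_eq_flip_of_range_eq (hφ : IsCubeMap φ) {k l : Fin (q + 1)} (hkl : k ≠ l)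
    {c d : Bool} (hk : Function.Injective (facet φ k c)) (hl : Function.Injective (facet φ l d))
    (hr : Set.range (facet φ k c) = Set.range (facet φ l d)) {x : Fin (q + 1) → Bool}
    (hxk : x k = c) (hxl : x l = d) : φ (flip x k) = φ (flip x l) := by
  obtain ⟨j, rfl⟩ := Fin.exists_succAbove_eq hkl.symm
  obtain ⟨δ, hδ⟩ := ((hφ.facet k c).isStep_edge hk j).exists_ne
  -- The coordinate `δ` on the first facet is constant on its intersection with the second one.
  have hcoord := (hφ.facet k c).apply_eq hk hδ
  have h1 : φ (flip x k) ∈ Set.range (facet φ k c) := by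
    rw [hr, mem_range_facet]
    exact ⟨_, by rw [flip_of_ne _ hkl.symm, hxl], rfl⟩
  -- A vertex `t` of the first facet with the same image as `flip x k` lies off the second facet.
  obtain ⟨t, ht⟩ := h1
  obtain ⟨s, rfl⟩ := exists_insertNth hxk
  rw [Fin.insertNth_apply_succAbove] at hxl
  have htj : t j = !d := by
    by_contra hne
    have htd : t j = d := by cases h1 : t j <;> cases h2 : d <;> simp_all
    have := eq_of_facet_injective hl (x := k.insertNth c t) (by simpa using htd)
      (by rw [flip_of_ne _ hkl.symm]; simpa using hxl) ht
    have := congrFun this k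
    simp at this
  have hkδ : (φ (flip (k.insertNth c s) k) - φ (k.insertNth c s)) δ
      = (φ (flip (k.insertNth c s) (k.succAbove j)) - φ (k.insertNth c s)) δ := by
    rw [← ht, flip_insertNth_succAbove]
    change (facet φ k c t - facet φ k c s) δ = (facet φ k c _ - facet φ k c s) δ
    rw [Pi.sub_apply, Pi.sub_apply, hcoord t, hcoord (flip s j), flip_same, htj, hxl]
  have hne : (φ (flip (k.insertNth c s) (k.succAbove j)) - φ (k.insertNth c s)) δ ≠ 0 := by
    rw [flip_insertNth_succAbove]
    change (facet φ k c (flip s j) - facet φ k c s) δ ≠ 0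
    rw [(hφ.facet k c).flip_eq hk]
    cases s j <;> simpa using hδ
  have e1 := (hφ (k.insertNth c s) k).eq_single (hkδ ▸ hne)
  have e2 := (hφ (k.insertNth c s) (k.succAbove j)).eq_single hne
  rw [hkδ, ← e2] at e1
  exact sub_left_injective e1

/-- The contributions to the boundary of two facets in different directions that have the same
image cancel. -/
theorem det_edgeMatrix_facet_of_range_eq (hφ : IsCubeMap φ) {k l : Fin (q + 1)} (hkl : k ≠ l)
    {c d : Bool} (hk : Function.Injective (facet φ k c)) (hl : Function.Injective (facet φ l d))
    (hr : Set.range (facet φ k c) = Set.range (facet φ l d)) (e : Fin q → Fin m) :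
    (-1) ^ ((k : ℕ) + 1) * bsign c * (edgeMatrix (facet φ k c) e).det =
      -((-1) ^ ((l : ℕ) + 1) * bsign d * (edgeMatrix (facet φ l d) e).det) := by
  obtain ⟨j, rfl⟩ := Fin.exists_succAbove_eq hkl.symm
  obtain ⟨q, rfl⟩ : ∃ q', q = q' + 1 := ⟨q - 1, by have := j.pos; omega⟩
  obtain ⟨x, hxk, hxl⟩ : ∃ x : Fin (q + 2) → Bool, x k = c ∧ x (k.succAbove j) = d :=
    ⟨k.insertNth c fun _ => d, by simp, by simp⟩
  have hflip := flip_eq_flip_of_range_eq hφ hkl hk hl hr hxk hxl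
  have hs := Fin.succAbove_succAbove_predAbove k j
  have hsign := Fin.neg_one_pow_succAbove_add_predAbove (R := ℤ) k j
  -- The edge vectors of both facets, computed at the common vertex `x`.
  have edge_k : ∀ b, edge (facet φ k c) b =
      bsign (x (k.succAbove b)) • (φ (flip x (k.succAbove b)) - φ x) := fun b => by
    obtain ⟨s, rfl⟩ := exists_insertNth hxk
    rw [(hφ.facet k c).edge_eq hk s b, facet_flip, Fin.insertNth_apply_succAbove,
      facet]
  have edge_l : ∀ b, edge (facet φ (k.succAbove j) d) b =
      bsign (x ((k.succAbove j).succAbove b)) •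
        (φ (flip x ((k.succAbove j).succAbove b)) - φ x) := fun b => by
    obtain ⟨s, hs⟩ := exists_insertNth hxl
    rw [(hφ.facet _ d).edge_eq hl s b, facet_flip, hs, Fin.insertNth_apply_succAbove,
      facet]
  -- Both determinants are expanded along the column of the edge that leaves the other facet; the
  -- minors then agree.
  rw [Matrix.det_succ_column _ j, Matrix.det_succ_column _ (j.predAbove k), Finset.mul_sum,
    Finset.mul_sum, ← Finset.sum_neg_distrib]
  refine Finset.sum_congr rfl fun a _ => ?_
  have hminor : (edgeMatrix (facet φ k c) e).submatrix a.succAbove j.succAbove =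
      (edgeMatrix (facet φ (k.succAbove j) d) e).submatrix a.succAbove
        (j.predAbove k).succAbove := by
    ext a' b
    simp only [edgeMatrix, Matrix.submatrix_apply, Matrix.of_apply, edge_k, edge_l]
    rw [Fin.succAbove_succAbove_succAbove_predAbove]
  rw [hminor]
  simp only [edgeMatrix, Matrix.of_apply, edge_k, edge_l, hs, hxk, hxl, hflip, Pi.smul_apply,
    smul_eq_mul]
  rw [pow_add, pow_add] at hsign
  simp only [pow_add, pow_one]
  generalize Matrix.det (_ : Matrix (Fin q) (Fin q) ℤ) = D
  generalize (φ (flip x (k.succAbove j)) - φ x) (e a) = w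
  linear_combination (-(bsign c * bsign d * (-1) ^ (a : ℕ) * w * D)) * hsign

end Facets

/-! ### Parametrised elementary cubes -/

namespace ElemCube

variable {n q : ℕ}

theorem hi_eq_of_mem_nondeg {Q : ElemCube n} {i : Fin n} (h : i ∈ Q.nondeg) :
    Q.hi i = Q.lo i + 1 :=
  (Q.elementary i).resolve_left fun e => mem_nondeg.1 h e.symm

theorem exists_dir_eq (Q : ElemCube n) (h : Q.dim = q) {i : Fin n} (hi : i ∈ Q.nondeg) :
    ∃ b, Q.dir h b = i := by
  have : i ∈ Set.range (Q.dir h) := (Finset.range_orderEmbOfFin Q.nondeg h).symm ▸ hi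
  exact this

open scoped Classical in
/-- The vertex `s` of a `q`-cube, the nondegenerate coordinates being taken in increasing
order. -/
def point (Q : ElemCube n) (h : Q.dim = q) (s : Fin q → Bool) : Fin n → ℤ :=
  fun i => if ∃ b, Q.dir h b = i ∧ s b = true then Q.hi i else Q.lo i

theorem point_dir (Q : ElemCube n) (h : Q.dim = q) (s : Fin q → Bool) (b : Fin q) :
    Q.point h s (Q.dir h b) = if s b then Q.hi (Q.dir h b) else Q.lo (Q.dir h b) := by
  simp [point]

theorem point_of_notMem (Q : ElemCube n) (h : Q.dim = q) (s : Fin q → Bool) {i : Fin n}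
    (hi : i ∉ Q.nondeg) : Q.point h s i = Q.lo i := by
  rw [point, if_neg]
  rintro ⟨b, rfl, -⟩
  exact hi (Q.dir_mem h b)

theorem point_eq_iff (Q : ElemCube n) (h : Q.dim = q) (s : Fin q → Bool) (x : Fin n → ℤ) :
    Q.point h s = x ↔ (∀ b, x (Q.dir h b) = if s b then Q.hi (Q.dir h b) else Q.lo (Q.dir h b)) ∧
      ∀ i ∉ Q.nondeg, x i = Q.lo i := by
  constructor
  · rintro rfl
    exact ⟨fun b => Q.point_dir h s b, fun i hi => Q.point_of_notMem h s hi⟩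
  · rintro ⟨h1, h2⟩
    funext i
    by_cases hi : i ∈ Q.nondeg
    · obtain ⟨b, rfl⟩ := Q.exists_dir_eq h hi
      rw [h1, point_dir]
    · rw [h2 i hi, Q.point_of_notMem h s hi]

theorem point_mem (Q : ElemCube n) (h : Q.dim = q) (s : Fin q → Bool) :
    Q.point h s ∈ Q.toSet := by
  rw [mem_toSet]
  intro i
  rw [point]
  split_ifs
  · exact Or.inr rfl
  · exact Or.inl rfl

theorem point_injective (Q : ElemCube n) (h : Q.dim = q) : Function.Injective (Q.point h) := by
  intro s t e
  funext b
  have := congrFun e (Q.dir h b)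
  rw [point_dir, point_dir] at this
  have := mem_nondeg.1 (Q.dir_mem h b)
  cases h1 : s b <;> cases h2 : t b <;> simp_all

theorem range_point (Q : ElemCube n) (h : Q.dim = q) : Set.range (Q.point h) = Q.toSet := by
  ext x
  refine ⟨fun ⟨s, hs⟩ => hs ▸ Q.point_mem h s, fun hx => ?_⟩
  rw [mem_toSet] at hx
  refine ⟨fun b => decide (x (Q.dir h b) = Q.hi (Q.dir h b)),
    (Q.point_eq_iff h _ x).2 ⟨fun b => ?_, fun i hi => ?_⟩⟩
  · have := hx (Q.dir h b)
    split_ifs with hb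
    · simpa using hb
    · exact this.resolve_right (by simpa using hb)
  · rw [mem_nondeg, not_not] at hi
    have := hx i
    rwa [← hi, or_self] at this

theorem point_origin (Q : ElemCube n) (h : Q.dim = q) : Q.point h (origin q) = Q.lo :=
  (Q.point_eq_iff h _ _).2 ⟨fun b => by simp [origin], fun _ _ => rfl⟩

theorem point_flip (Q : ElemCube n) (h : Q.dim = q) (s : Fin q → Bool) (k : Fin q) :
    Q.point h (flip s k) = Q.point h s + Pi.single (Q.dir h k) (bsign (s k)) := by
  rw [point_eq_iff]
  refine ⟨fun b => ?_, fun i hi => ?_⟩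
  · rw [Pi.add_apply, point_dir]
    by_cases hb : b = k
    · subst hb
      rw [flip_same, Pi.single_eq_same, hi_eq_of_mem_nondeg (Q.dir_mem h b)]
      cases s b <;> simp
    · rw [flip_of_ne _ hb, Pi.single_eq_of_ne (fun e => hb ((Q.dir h).injective e)), add_zero]
  · rw [Pi.add_apply, Q.point_of_notMem h s hi, Pi.single_eq_of_ne, add_zero]
    rintro rfl
    exact hi (Q.dir_mem h k)

theorem point_flip_origin (Q : ElemCube n) (h : Q.dim = q) (k : Fin q) :
    Q.point h (flip (origin q) k) = Q.vertex (Q.dir h k) := by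
  rw [point_eq_iff]
  refine ⟨fun b => ?_, fun i hi => ?_⟩
  · by_cases hb : b = k
    · subst hb; simp [vertex, origin]
    · rw [vertex, Function.update_of_ne (fun e => hb ((Q.dir h).injective e)), flip_of_ne _ hb]
      simp [origin]
  · rw [vertex, Function.update_of_ne]
    rintro rfl
    exact hi (Q.dir_mem h k)

theorem mem_faceA {Q : ElemCube n} {i : Fin n} {x : Fin n → ℤ} :
    x ∈ (Q.faceA i).toSet ↔ x ∈ Q.toSet ∧ x i = Q.lo i := by
  refine ⟨fun h => ⟨Q.faceA_subset i h, ?_⟩, fun ⟨h, hi⟩ => ?_⟩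
  · simpa [faceA] using mem_toSet.1 h i
  · rw [mem_toSet] at h ⊢
    intro k
    by_cases hk : k = i
    · subst hk; exact Or.inl hi
    · simpa [faceA, hk] using h k

theorem mem_faceB {Q : ElemCube n} {i : Fin n} {x : Fin n → ℤ} :
    x ∈ (Q.faceB i).toSet ↔ x ∈ Q.toSet ∧ x i = Q.hi i := by
  refine ⟨fun h => ⟨Q.faceB_subset i h, ?_⟩, fun ⟨h, hi⟩ => ?_⟩
  · simpa [faceB] using mem_toSet.1 h i
  · rw [mem_toSet] at h ⊢
    intro k
    by_cases hk : k = i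
    · subst hk; exact Or.inr hi
    · simpa [faceB, hk] using h k

theorem point_faceA (Q : ElemCube n) (h : Q.dim = q + 1) (k : Fin (q + 1)) (s : Fin q → Bool) :
    (Q.faceA (Q.dir h k)).point (Q.dim_faceA h k) s = Q.point h (k.insertNth false s) := by
  rw [point_eq_iff]
  refine ⟨fun b => ?_, fun i hi => ?_⟩
  · have hne : Q.dir h (k.succAbove b) ≠ Q.dir h k := fun e =>
      Fin.succAbove_ne k b ((Q.dir h).injective e)
    rw [Q.dir_of_nondeg_eq _ h k _ (Q.nondeg_faceA _), point_dir, Fin.insertNth_apply_succAbove]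
    simp [faceA, hne]
  · rw [nondeg_faceA, Finset.mem_erase, not_and_or, not_not] at hi
    rcases hi with rfl | hi
    · rw [point_dir]; simp [faceA]
    · rw [Q.point_of_notMem h _ hi]; rfl

theorem point_faceB (Q : ElemCube n) (h : Q.dim = q + 1) (k : Fin (q + 1)) (s : Fin q → Bool) :
    (Q.faceB (Q.dir h k)).point (Q.dim_faceB h k) s = Q.point h (k.insertNth true s) := by
  rw [point_eq_iff]
  refine ⟨fun b => ?_, fun i hi => ?_⟩
  · have hne : Q.dir h (k.succAbove b) ≠ Q.dir h k := fun e =>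
      Fin.succAbove_ne k b ((Q.dir h).injective e)
    rw [Q.dir_of_nondeg_eq _ h k _ (Q.nondeg_faceB _), point_dir, Fin.insertNth_apply_succAbove]
    simp [faceB, hne]
  · rw [nondeg_faceB, Finset.mem_erase, not_and_or, not_not] at hi
    rcases hi with rfl | hi
    · rw [point_dir]; simp [faceB]
    · rw [Q.point_of_notMem h _ hi]
      have hne : i ≠ Q.dir h k := fun e => hi (e ▸ Q.dir_mem h k)
      simp [faceB, hne]

/-- A map from `{0,1}^q` onto a `q`-cube is injective. -/
theorem injective_of_range_eq (R : ElemCube n) (h : R.dim = q) {ψ : (Fin q → Bool) → Fin n → ℤ}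
    (hψ : Set.range ψ = R.toSet) : Function.Injective ψ := by
  have hg : ∀ s, ∃ t, R.point h t = ψ s := fun s => by
    have : ψ s ∈ Set.range (R.point h) := by
      rw [R.range_point h, ← hψ]; exact Set.mem_range_self s
    exact this
  choose g hg using hg
  have hsurj : Function.Surjective g := fun t => by
    have : R.point h t ∈ Set.range ψ := hψ ▸ R.point_mem h t
    obtain ⟨s, hs⟩ := this
    exact ⟨s, R.point_injective h (by rw [hg, hs])⟩
  intro s t e
  exact Finite.injective_iff_surjective.2 hsurj
    (R.point_injective h (by rw [hg, hg, e]))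

/-- The cube swept out by moving `R` one step in a degenerate direction. -/
theorem exists_sweep (R : ElemCube n) (h : R.dim = q) {δ : Fin n} (hδ : δ ∉ R.nondeg) {σ : ℤ}
    (hσ : σ = 1 ∨ σ = -1) :
    ∃ R' : ElemCube n, R'.dim = q + 1 ∧
      ∀ x, x ∈ R'.toSet ↔ x ∈ R.toSet ∨ ∃ y ∈ R.toSet, x = y + Pi.single δ σ := by
  have hδ' : R.hi δ = R.lo δ := by
    by_contra e; exact hδ (mem_nondeg.2 (Ne.symm e))
  refine ⟨⟨Function.update R.lo δ (min (R.lo δ) (R.lo δ + σ)),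
    Function.update R.hi δ (max (R.lo δ) (R.lo δ + σ)), fun i => ?_⟩, ?_, fun x => ?_⟩
  · by_cases hi : i = δ
    · subst hi; simp only [Function.update_self]; omega
    · simpa [hi] using R.elementary i
  · rw [dim, ← h, dim, ← Finset.card_insert_of_notMem hδ]
    congr 1
    ext i
    rw [Finset.mem_insert, mem_nondeg, mem_nondeg]
    by_cases hi : i = δ
    · subst hi; simp only [Function.update_self, true_or, iff_true]; omega
    · simp [hi]
  · simp only [mem_toSet]
    constructor
    · intro hx
      have hxδ := hx δ
      simp only [Function.update_self] at hxδ
      have hx' : ∀ i, i ≠ δ → (x i = R.lo i ∨ x i = R.hi i) := fun i hi => by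
        simpa [hi] using hx i
      by_cases h0 : x δ = R.lo δ
      · left
        intro i
        by_cases hi : i = δ
        · subst hi; exact Or.inl h0
        · exact hx' i hi
      · right
        refine ⟨x - Pi.single δ σ, fun i => ?_, by simp⟩
        by_cases hi : i = δ
        · subst hi; simp only [Pi.sub_apply, Pi.single_eq_same]; omega
        · simpa [hi] using hx' i hi
    · rintro (hx | ⟨y, hy, rfl⟩) i
      · have := hx i
        by_cases hi : i = δ
        · subst hi; simp only [Function.update_self]; omega
        · simpa [hi] using this
      · have := hy i
        by_cases hi : i = δ
        · subst hi; simp only [Function.update_self, Pi.add_apply, Pi.single_eq_same]; omega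
        · simpa [hi] using this

end ElemCube

/-! ### The boundary of the image of a cube -/

section Boundary

variable {q m : ℕ} {φ : (Fin (q + 1) → Bool) → Fin m → ℤ}

open scoped Classical in
/-- The coefficient of the `q`-cube `R` in the chain `ε · ψ({0,1}^q)`: the orientation of `ψ` if
`ψ` maps `{0,1}^q` onto `R`, and `0` otherwise. -/
noncomputable def coeffAt (ψ : (Fin q → Bool) → Fin m → ℤ) (R : ElemCube m) (h : R.dim = q) : ℤ :=
  if Set.range ψ = R.toSet then (edgeMatrix ψ (R.dir h)).det else 0

/-- The contribution of the facet `(k, c)` of the standard cube to the coefficient of `R` in the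
image of the boundary. -/
noncomputable def facetTerm (φ : (Fin (q + 1) → Bool) → Fin m → ℤ) (R : ElemCube m) (h : R.dim = q)
    (k : Fin (q + 1)) (c : Bool) : ℤ :=
  (-1) ^ ((k : ℕ) + 1) * bsign c * coeffAt (facet φ k c) R h

variable {R : ElemCube m} {hR : R.dim = q}

theorem facetTerm_of_range_ne {k : Fin (q + 1)} {c : Bool}
    (h : Set.range (facet φ k c) ≠ R.toSet) : facetTerm φ R hR k c = 0 := by
  rw [facetTerm, coeffAt, if_neg h, mul_zero]

theorem facetTerm_add_facetTerm (hφ : IsCubeMap φ) {k l : Fin (q + 1)} (hkl : k ≠ l) {c d : Bool}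
    (hk : Set.range (facet φ k c) = R.toSet) (hl : Set.range (facet φ l d) = R.toSet) :
    facetTerm φ R hR k c + facetTerm φ R hR l d = 0 := by
  rw [facetTerm, facetTerm, coeffAt, coeffAt, if_pos hk, if_pos hl,
    det_edgeMatrix_facet_of_range_eq hφ hkl (R.injective_of_range_eq hR hk)
      (R.injective_of_range_eq hR hl) (hk.trans hl.symm), neg_add_cancel]

/-- Facets in three different directions cannot have the same `q`-cube as image. -/
theorem range_facet_ne_of_ne (hR : R.dim = q) (hφ : IsCubeMap φ) {k l p : Fin (q + 1)}
    (hkl : k ≠ l) (hkp : k ≠ p) (hlp : l ≠ p) {c d : Bool}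
    (hk : Set.range (facet φ k c) = R.toSet) (hl : Set.range (facet φ l d) = R.toSet) (e : Bool) :
    Set.range (facet φ p e) ≠ R.toSet := by
  intro hp
  have ik := R.injective_of_range_eq hR hk
  obtain ⟨x, h1, h2, h3⟩ : ∃ x : Fin (q + 1) → Bool, x k = c ∧ x l = d ∧ x p = e :=
    ⟨fun i => if i = k then c else if i = l then d else e, by simp, by simp [hkl.symm],
      by simp [hkp.symm, hlp.symm]⟩
  have e1 := flip_eq_flip_of_range_eq hφ hkl ik (R.injective_of_range_eq hR hl)
    (hk.trans hl.symm) h1 h2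
  have e2 := flip_eq_flip_of_range_eq hφ hkp ik (R.injective_of_range_eq hR hp)
    (hk.trans hp.symm) h1 h3
  exact hlp (flip_injective x (eq_of_facet_injective ik (by rw [flip_of_ne _ hkl, h1])
    (by rw [flip_of_ne _ hkp, h1]) (e1.symm.trans e2)))

/-- If two opposite facets and a third facet have image `R`, then so has the facet opposite to the
third one. -/
theorem range_facet_not (hR : R.dim = q) {k l : Fin (q + 1)} {c d : Bool}
    (hk : Set.range (facet φ k c) = R.toSet) (hk' : Set.range (facet φ k (!c)) = R.toSet)
    (hl : Set.range (facet φ l d) = R.toSet) : Set.range (facet φ l (!d)) = R.toSet := by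
  have il := R.injective_of_range_eq hR hl
  ext y
  constructor
  · rw [mem_range_facet]
    rintro ⟨x, -, rfl⟩
    by_cases hx : x k = c
    · rw [← hk, mem_range_facet]; exact ⟨x, hx, rfl⟩
    · rw [← hk', mem_range_facet]; exact ⟨x, by rwa [Bool.eq_not_iff], rfl⟩
  · intro hy
    have hy' := hy
    rw [← hk, mem_range_facet] at hy
    rw [← hk', mem_range_facet] at hy'
    obtain ⟨x, hx, rfl⟩ := hy
    obtain ⟨x', hx', h⟩ := hy'
    rw [mem_range_facet]
    by_cases h1 : x l = d
    · by_cases h2 : x' l = d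
      · have := eq_of_facet_injective il h2 h1 h
        subst this
        simp [hx] at hx'
      · exact ⟨x', by rwa [Bool.eq_not_iff], h⟩
    · exact ⟨x, by rwa [Bool.eq_not_iff], rfl⟩

/-- If a cube map is not an embedding of the cube `{0,1}^(q+1)`, then the images of the facets
cancel in the image of the boundary. -/
theorem sum_facetTerm_eq_zero (hq : q ≤ 3) (hφ : IsCubeMap φ)
    (hne : ¬ ∃ R' : ElemCube m, R'.dim = q + 1 ∧ Set.range φ = R'.toSet) :
    ∑ k, (facetTerm φ R hR k false + facetTerm φ R hR k true) = 0 := by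
  have hpair : ∀ k c, facetTerm φ R hR k false + facetTerm φ R hR k true =
      facetTerm φ R hR k c + facetTerm φ R hR k (!c) := fun k c => by
    cases c
    · rfl
    · exact add_comm _ _
  by_cases hex : ∃ t c, Set.range (facet φ t c) = R.toSet
  swap
  · push Not at hex
    exact Finset.sum_eq_zero fun k _ => by
      rw [facetTerm_of_range_ne (hex k _), facetTerm_of_range_ne (hex k _), add_zero]
  obtain ⟨t, c, ht⟩ := hex
  by_cases hside : ∃ l, l ≠ t ∧ ∃ d, Set.range (facet φ l d) = R.toSet
  · obtain ⟨l, hlt, d, hl⟩ := hside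
    rw [Finset.sum_eq_add t l hlt.symm (fun p _ hp => by
      have := range_facet_ne_of_ne hR hφ hlt.symm hp.1.symm hp.2.symm ht hl
      rw [facetTerm_of_range_ne (this _), facetTerm_of_range_ne (this _), add_zero])
      (by simp) (by simp), hpair t c, hpair l d]
    have h1 := facetTerm_add_facetTerm (hR := hR) hφ hlt.symm ht hl
    have h2 : facetTerm φ R hR t (!c) + facetTerm φ R hR l (!d) = 0 := by
      by_cases h : Set.range (facet φ t (!c)) = R.toSet
      · exact facetTerm_add_facetTerm hφ hlt.symm h (range_facet_not hR ht h hl)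
      · rw [facetTerm_of_range_ne h, facetTerm_of_range_ne
          (fun h' => h (range_facet_not hR hl h' ht)), add_zero]
    linarith
  · push Not at hside
    rw [Finset.sum_eq_single t (fun p _ hp => by
      rw [facetTerm_of_range_ne (hside p hp _), facetTerm_of_range_ne (hside p hp _), add_zero])
      (by simp), hpair t c]
    have hi := R.injective_of_range_eq hR ht
    -- It remains to see that the opposite facet has the same image and the same orientation.
    suffices h : Set.range (facet φ t (!c)) = R.toSet ∧
        (edgeMatrix (facet φ t (!c)) (R.dir hR)).det =
          (edgeMatrix (facet φ t c) (R.dir hR)).det by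
      rw [facetTerm, facetTerm, coeffAt, coeffAt, if_pos ht, if_pos h.1, h.2, bsign_not]
      ring
    rcases (hφ.facet t c).cases_of_near hq hi (hφ.facet t (!c)) (hφ.near_facet t c) with
      ⟨j, d, h⟩ | h | ⟨i, j, hij, h⟩ | ⟨v, hv, htr, h⟩
    · refine absurd ?_ (hside (t.succAbove j) (Fin.succAbove_ne t j) d)
      rw [← ht]
      ext y
      constructor
      · rw [mem_range_facet]
        rintro ⟨x, hx, rfl⟩
        by_cases hxt : x t = c
        · exact mem_range_facet.2 ⟨x, hxt, rfl⟩
        · obtain ⟨s, rfl⟩ := exists_insertNth (Bool.eq_not_iff.2 hxt)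
          exact ⟨flip s j, (h s (by simpa using hx)).symm⟩
      · rintro ⟨s, rfl⟩
        by_cases hs : s j = d
        · exact mem_range_facet.2 ⟨t.insertNth c s, by simpa using hs, rfl⟩
        · refine mem_range_facet.2 ⟨t.insertNth (!c) (flip s j), ?_, ?_⟩
          · rw [Fin.insertNth_apply_succAbove, flip_same, Bool.not_eq_eq_eq_not]
            exact Bool.eq_not_iff.2 hs
          · have := h (flip s j) (by
              rw [flip_same, Bool.not_eq_eq_eq_not]; exact Bool.eq_not_iff.2 hs)
            rwa [flip_flip] at this
    · rw [h]; exact ⟨ht, rfl⟩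
    · refine ⟨?_, det_edgeMatrix_rotation (hφ.facet t c) hi hij h _⟩
      rw [← ht, show facet φ t (!c) = facet φ t c ∘
        (fun s => flip s (if s i = s j then i else j)) from funext h,
        (surjective_flip_ite hij).range_comp]
    · refine absurd ?_ hne
      obtain ⟨δ, σ, hσ, rfl⟩ := hv
      have hδ : δ ∉ R.nondeg := fun hδ => by
        obtain ⟨s, hs⟩ : R.lo ∈ Set.range (facet φ t c) := ht ▸ R.lo_mem
        obtain ⟨s', hs'⟩ : R.hi ∈ Set.range (facet φ t c) := ht ▸ R.hi_mem
        refine ElemCube.mem_nondeg.1 hδ ?_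
        rw [← hs, ← hs']
        exact (hφ.facet t c).apply_eq_of_edge_eq_zero hi
          (fun k => htr k δ (by rcases hσ with rfl | rfl <;> simp)) _ _
      obtain ⟨R', hR', hmem⟩ := R.exists_sweep hR hδ hσ
      refine ⟨R', hR', ?_⟩
      ext y
      rw [hmem, ← ht]
      constructor
      · rintro ⟨x, rfl⟩
        by_cases hx : x t = c
        · exact Or.inl (mem_range_facet.2 ⟨x, hx, rfl⟩)
        · obtain ⟨s, rfl⟩ := exists_insertNth (Bool.eq_not_iff.2 hx)
          exact Or.inr ⟨_, ⟨s, rfl⟩, h s⟩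
      · rintro (⟨s, rfl⟩ | ⟨_, ⟨s, rfl⟩, rfl⟩)
        · exact ⟨_, rfl⟩
        · exact ⟨t.insertNth (!c) s, h s⟩

theorem edge_facet (hφ : IsCubeMap φ) (hi : Function.Injective φ) (k : Fin (q + 1)) (c : Bool)
    (b : Fin q) : edge (facet φ k c) b = edge φ (k.succAbove b) := by
  rw [edge, facet_flip, hφ.flip_eq hi, Fin.insertNth_apply_succAbove, facet,
    add_sub_cancel_left, origin, bsign_false, one_smul]

open scoped Classical in
/-- An embedding maps the boundary of the cube `{0,1}^(q+1)` to the boundary of its image, with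
the orientation as coefficient. -/
theorem sum_facetTerm_eq_of_range_eq (hφ : IsCubeMap φ) (R' : ElemCube m) (hR' : R'.dim = q + 1)
    (h : Set.range φ = R'.toSet) :
    ∑ k, (facetTerm φ R hR k false + facetTerm φ R hR k true) =
      (edgeMatrix φ (R'.dir hR')).det * ∑ k : Fin (q + 1), (-1) ^ ((k : ℕ) + 1) *
        ((if R'.faceA (R'.dir hR' k) = R then 1 else 0) -
          if R'.faceB (R'.dir hR' k) = R then 1 else 0) := by
  have hi := R'.injective_of_range_eq hR' h
  have hmem : ∀ x, φ x ∈ R'.toSet := fun x => h ▸ Set.mem_range_self x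
  -- The permutation underlying the embedding.
  have hσ : ∀ k, ∃ a, edge φ k (R'.dir hR' a) ≠ 0 := fun k => by
    obtain ⟨d, hd⟩ := (hφ.isStep_edge hi k).exists_ne
    have hdn : d ∈ R'.nondeg := by
      rw [ElemCube.mem_nondeg]
      intro e
      have h1 := ElemCube.mem_toSet.1 (hmem (flip (origin _) k)) d
      have h2 := ElemCube.mem_toSet.1 (hmem (origin _)) d
      refine hd ?_
      rw [edge, Pi.sub_apply]
      omega
    obtain ⟨a, rfl⟩ := R'.exists_dir_eq hR' hdn
    exact ⟨a, hd⟩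
  choose σ hσ using hσ
  have hσi : Function.Injective σ := fun k j e => by
    by_contra hkj
    exact hσ j (e ▸ hφ.edge_apply_eq_zero hi hkj (hσ k))
  have hσb : Function.Bijective σ := Finite.injective_iff_bijective.1 hσi
  rw [← hσb.sum_comp (fun k : Fin (q + 1) => (-1) ^ ((k : ℕ) + 1) *
        ((if R'.faceA (R'.dir hR' k) = R then (1 : ℤ) else 0) -
          if R'.faceB (R'.dir hR' k) = R then 1 else 0)), Finset.mul_sum]
  refine Finset.sum_congr rfl fun k _ => ?_
  set δ := R'.dir hR' (σ k) with hδ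
  set D := ((edgeMatrix φ (R'.dir hR')).submatrix (σ k).succAbove k.succAbove).det with hD
  have hdet : (edgeMatrix φ (R'.dir hR')).det =
      (-1) ^ ((σ k : ℕ) + (k : ℕ)) * edge φ k δ * D := by
    rw [Matrix.det_succ_column _ k, Finset.sum_eq_single (σ k)]
    · rfl
    · intro a _ ha
      have : edge φ k (R'.dir hR' a) = 0 := by
        rw [(hφ.isStep_edge hi k).eq_single (hσ k), Pi.single_eq_of_ne]
        exact fun e => ha ((R'.dir hR').injective e)
      simp [edgeMatrix, this]
    · simp
  -- A facet of the cube with image `F` contributes the minor `D` to the coefficient of `F`.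
  have hcoeff : ∀ (F : ElemCube m) (c : Bool), Set.range (facet φ k c) = F.toSet →
      F.nondeg = R'.nondeg.erase δ →
      coeffAt (facet φ k c) R hR = D * if F = R then 1 else 0 := fun F c hF hn => by
    rw [coeffAt, hF]
    by_cases hFR : F = R
    · subst hFR
      rw [if_pos rfl, if_pos rfl, mul_one, hD]
      congr 1
      ext a b
      simp only [edgeMatrix, Matrix.submatrix_apply, Matrix.of_apply]
      rw [edge_facet hφ hi, R'.dir_of_nondeg_eq F hR' (σ k) hR hn]
    · rw [if_neg hFR, if_neg fun e => hFR (ElemCube.toSet_injective e), mul_zero]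
  have happ : ∀ x, φ x δ = φ (origin _) δ + if x k then edge φ k δ else 0 :=
    hφ.apply_eq hi (hσ k)
  have hhi : R'.hi δ = R'.lo δ + 1 := ElemCube.hi_eq_of_mem_nondeg (R'.dir_mem hR' _)
  have h0 := ElemCube.mem_toSet.1 (hmem (origin _)) δ
  have h1 := ElemCube.mem_toSet.1 (hmem (flip (origin _) k)) δ
  rw [happ (flip _ k), flip_same] at h1
  simp only [origin, Bool.not_false, if_true] at h1 h0 happ
  have hrange : ∀ (F : ElemCube m) (z : ℤ) (c : Bool),
      (∀ y, y ∈ F.toSet ↔ y ∈ R'.toSet ∧ y δ = z) → (∀ x, φ x δ = z ↔ x k = c) →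
      Set.range (facet φ k c) = F.toSet := fun F z c hF hc => by
    ext y
    rw [mem_range_facet, hF, ← h]
    constructor
    · rintro ⟨x, hx, rfl⟩
      exact ⟨⟨x, rfl⟩, (hc x).2 hx⟩
    · rintro ⟨⟨x, rfl⟩, hx⟩
      exact ⟨x, (hc x).1 hx, rfl⟩
  have hsq : ((-1 : ℤ) ^ (σ k : ℕ)) * (-1) ^ (σ k : ℕ) = 1 := by rw [← mul_pow]; simp
  rw [facetTerm, facetTerm, hdet]
  rcases ((hφ.isStep_edge hi k).apply_cases δ).resolve_left (hσ k) with hs | hs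
  · rw [hs] at h1 happ
    rw [hcoeff (R'.faceA δ) false (hrange _ (R'.lo δ) _ (fun y => ElemCube.mem_faceA)
        fun x => by rw [happ]; cases x k <;> simp <;> omega) (R'.nondeg_faceA δ),
      hcoeff (R'.faceB δ) true (hrange _ (R'.hi δ) _ (fun y => ElemCube.mem_faceB)
        fun x => by rw [happ]; cases x k <;> simp <;> omega) (R'.nondeg_faceB δ), hs]
    simp only [pow_add, bsign_false, bsign_true]
    linear_combination ((-1) ^ (k : ℕ) * D * ((if R'.faceA δ = R then 1 else 0) -
      if R'.faceB δ = R then 1 else 0)) * hsq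
  · rw [hs] at h1 happ
    rw [hcoeff (R'.faceB δ) false (hrange _ (R'.hi δ) _ (fun y => ElemCube.mem_faceB)
        fun x => by rw [happ]; cases x k <;> simp <;> omega) (R'.nondeg_faceB δ),
      hcoeff (R'.faceA δ) true (hrange _ (R'.lo δ) _ (fun y => ElemCube.mem_faceA)
        fun x => by rw [happ]; cases x k <;> simp <;> omega) (R'.nondeg_faceA δ), hs]
    simp only [pow_add, bsign_false, bsign_true]
    linear_combination (-(-1) ^ (k : ℕ) * D * ((if R'.faceA δ = R then 1 else 0) -
      if R'.faceB δ = R then 1 else 0)) * hsq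

end Boundary

/-! ### Continuous functions on elementary cubes -/

section Parametrization

variable {n m q : ℕ} {X : Set (Fin n → ℤ)} {Y : Set (Fin m → ℤ)}

theorem IsStep.of_cAdj {x y : Fin m → ℤ} (h : CAdj 1 x y) : IsStep (x - y) := by
  obtain ⟨hne, hle, hcard⟩ := h
  obtain ⟨d, hd⟩ := Function.ne_iff.1 hne
  refine ⟨d, x d - y d, ?_, ?_⟩
  · have := abs_le.1 (hle d)
    omega
  · funext i
    by_cases hi : i = d
    · subst hi; simp
    · rw [Pi.single_eq_of_ne hi, Pi.sub_apply, sub_eq_zero]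
      by_contra h'
      exact hi (Finset.card_le_one.1 hcard i (by simpa using h') d (by simpa using hd))

theorem IsStep.cAdj {x y : Fin m → ℤ} (h : IsStep (x - y)) : CAdj 1 x y := by
  refine ⟨fun e => h.ne_zero (sub_eq_zero.2 e), fun i => ?_, Finset.card_le_one.2 ?_⟩
  · have := h.apply_cases i
    rw [Pi.sub_apply] at this
    rw [abs_le]
    omega
  · intro i hi j hj
    simp only [Finset.mem_filter, Finset.mem_univ, true_and] at hi hj
    by_contra hij
    have := congrFun (h.eq_single (d := i) (sub_ne_zero.2 hi)) j
    rw [Pi.single_eq_of_ne (Ne.symm hij)] at this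
    exact hj (sub_eq_zero.1 this)

/-- The restriction of `f` to the cube `Q`, in terms of the nondegenerate coordinates of `Q`. -/
def onCube (f : X → Y) (Q : CubeIn X q) : (Fin q → Bool) → Fin m → ℤ :=
  fun s => f ⟨Q.1.point Q.2.1 s, Q.2.2 (Q.1.point_mem Q.2.1 s)⟩

theorem isCubeMap_onCube {f : X → Y} (hf : IsContinuous (C1Adj X) (C1Adj Y) f)
    (Q : CubeIn X q) : IsCubeMap (onCube f Q) := by
  intro s k
  rcases hf ⟨Q.1.point Q.2.1 (flip s k), Q.2.2 (Q.1.point_mem Q.2.1 _)⟩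
    ⟨Q.1.point Q.2.1 s, Q.2.2 (Q.1.point_mem Q.2.1 s)⟩ (by
      refine IsStep.cAdj ⟨Q.1.dir Q.2.1 k, bsign (s k), ?_, ?_⟩
      · cases s k <;> simp
      · change Q.1.point Q.2.1 (flip s k) - Q.1.point Q.2.1 s = _
        rw [Q.1.point_flip, add_sub_cancel_left]) with h | h
  · exact Or.inr (IsStep.of_cAdj h)
  · exact Or.inl (sub_eq_zero.2 (congrArg Subtype.val h))

theorem range_onCube (f : X → Y) (Q : CubeIn X q) : Set.range (onCube f Q) = imageSet f Q := by
  ext y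
  constructor
  · rintro ⟨s, rfl⟩
    exact ⟨_, Q.1.point_mem Q.2.1 s, rfl⟩
  · rintro ⟨⟨x, hx⟩, hxQ, rfl⟩
    obtain ⟨s, rfl⟩ : x ∈ Set.range (Q.1.point Q.2.1) := by rwa [Q.1.range_point]
    exact ⟨s, rfl⟩

theorem onCube_faceA (f : X → Y) (Q : CubeIn X (q + 1)) (k : Fin (q + 1)) :
    onCube f (Q.faceA k) = facet (onCube f Q) k false := by
  funext s
  unfold onCube facet
  congr 3
  exact Q.1.point_faceA Q.2.1 k s

theorem onCube_faceB (f : X → Y) (Q : CubeIn X (q + 1)) (k : Fin (q + 1)) :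
    onCube f (Q.faceB k) = facet (onCube f Q) k true := by
  funext s
  unfold onCube facet
  congr 3
  exact Q.1.point_faceB Q.2.1 k s

theorem linearPart_eq_edgeMatrix (f : X → Y) (Q : CubeIn X q) (R : CubeIn Y q) :
    linearPart f Q R = edgeMatrix (onCube f Q) (R.1.dir R.2.1) := by
  ext a b
  simp only [linearPart, edgeMatrix, Matrix.of_apply, edge, onCube, Pi.sub_apply]
  congr 4
  · simp only [Q.1.point_flip_origin]
  · simp only [Q.1.point_origin]

theorem mapCube_apply (f : X → Y) (Q : CubeIn X q) (R : CubeIn Y q) :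
    mapCube f Q R = coeffAt (onCube f Q) R.1 R.2.1 := by
  rw [mapCube, coeffAt, range_onCube]
  by_cases h : IsEmbeddingOn f Q
  · rw [dif_pos h, orientation, dif_pos h, Finsupp.smul_apply]
    by_cases hR : imageSet f Q = R.1.toSet
    · have e : imageCube f Q h = R := Subtype.ext (ElemCube.toSet_injective
        ((imageCube_toSet f Q h).trans hR))
      rw [if_pos hR, e, Finsupp.single_eq_same, linearPart_eq_edgeMatrix, smul_eq_mul, mul_one]
    · rw [if_neg hR, Finsupp.single_eq_of_ne, smul_zero]
      rintro rfl
      exact hR (imageCube_toSet f Q h).symm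
  · rw [dif_neg h, if_neg fun e => h ⟨R, e⟩]
    rfl

theorem isEmbeddingOn_of_range_eq {f : X → Y} {Q : CubeIn X q} {R : ElemCube m} (hR : R.dim = q)
    (h : Set.range (onCube f Q) = R.toSet) : IsEmbeddingOn f Q := by
  refine ⟨⟨R, hR, ?_⟩, by rw [← range_onCube, h]⟩
  rw [← h]
  rintro _ ⟨s, rfl⟩
  exact Subtype.coe_prop _

theorem inducedMap_single (f : X → Y) (Q : CubeIn X q) :
    inducedMap f q (Finsupp.single Q 1) = mapCube f Q := by
  simp [inducedMap]

theorem inducedMap_boundary_apply (f : X → Y) (Q : CubeIn X (q + 1)) (R : CubeIn Y q) :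
    inducedMap f q Q.boundary R = ∑ k, (facetTerm (onCube f Q) R.1 R.2.1 k false +
      facetTerm (onCube f Q) R.1 R.2.1 k true) := by
  simp only [CubeIn.boundary, map_sum, map_smul, map_sub, inducedMap_single,
    Finsupp.finsetSum_apply, Finsupp.smul_apply, Finsupp.sub_apply, mapCube_apply,
    onCube_faceA, onCube_faceB, facetTerm, bsign_false, bsign_true, smul_eq_mul]
  exact Finset.sum_congr rfl fun k _ => by ring

theorem inducedMap_boundary {f : X → Y} (hf : IsContinuous (C1Adj X) (C1Adj Y) f) (hq : q ≤ 3)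
    (Q : CubeIn X (q + 1)) :
    inducedMap f q Q.boundary = boundary Y q (mapCube f Q) := by
  classical
  have hφ := isCubeMap_onCube hf Q
  ext R
  rw [inducedMap_boundary_apply]
  by_cases h : IsEmbeddingOn f Q
  · have hr := (range_onCube f Q).trans (imageCube_toSet f Q h).symm
    rw [sum_facetTerm_eq_of_range_eq hφ _ (imageCube f Q h).2.1 hr, mapCube, dif_pos h,
      orientation, dif_pos h, map_smul, boundary_single, linearPart_eq_edgeMatrix,
      Finsupp.smul_apply, smul_eq_mul]
    congr 1
    have hs : ∀ F : CubeIn Y q, Finsupp.single F (1 : ℤ) R = if F.1 = R.1 then 1 else 0 :=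
      fun F => by
        rw [Finsupp.single_apply]
        exact if_congr Subtype.ext_iff rfl rfl
    simp only [CubeIn.boundary, Finsupp.finsetSum_apply, Finsupp.smul_apply, Finsupp.sub_apply,
      hs, smul_eq_mul]
    rfl
  · rw [mapCube, dif_neg h, map_zero, Finsupp.zero_apply]
    exact sum_facetTerm_eq_zero hq hφ fun ⟨R', hR', hr⟩ => h (isEmbeddingOn_of_range_eq hR' hr)

theorem c1Complex_d (X : Set (Fin n → ℤ)) (q : ℕ) :
    (c1Complex X).d (q + 1) q = ModuleCat.ofHom (boundary X q) :=
  ChainComplex.of_d (fun q => ModuleCat.of ℤ (Chain X q))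
    (fun q => ModuleCat.ofHom (boundary X q)) q

theorem inducedMap_comp_boundary (hn : n ≤ 4) {f : X → Y}
    (hf : IsContinuous (C1Adj X) (C1Adj Y) f) (q : ℕ) :
    inducedMap f q ∘ₗ boundary X q = boundary Y q ∘ₗ inducedMap f (q + 1) := by
  refine Finsupp.lhom_ext' fun Q => LinearMap.ext_ring ?_
  simp only [LinearMap.comp_apply, Finsupp.lsingle_apply, boundary_single, inducedMap_single]
  have hdim : Q.1.dim ≤ n := (Finset.card_le_univ _).trans_eq (Fintype.card_fin n)
  have := Q.2.1
  exact inducedMap_boundary hf (by omega) Q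

end Parametrization

end DigitalImage

theorem theorem5p1 {n m : ℕ} (hn : n ≤ 4)
    (X : Set (Fin n → ℤ)) (Y : Set (Fin m → ℤ)) (f : X → Y)
    (hf : DigitalImage.IsContinuous (DigitalImage.C1Adj X) (DigitalImage.C1Adj Y) f) :
    ∃ φ : DigitalImage.c1Complex X ⟶ DigitalImage.c1Complex Y,
      ∀ q : ℕ, φ.f q = ModuleCat.ofHom (DigitalImage.inducedMap f q) := by
  refine ⟨ChainComplex.ofHom (fun q => ModuleCat.ofHom (DigitalImage.inducedMap f q))
    fun q => ?_, fun q => rfl⟩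
  rw [DigitalImage.c1Complex_d, DigitalImage.c1Complex_d]
  change ModuleCat.ofHom (DigitalImage.boundary Y q ∘ₗ DigitalImage.inducedMap f (q + 1)) =
    ModuleCat.ofHom (DigitalImage.inducedMap f q ∘ₗ DigitalImage.boundary X q)
  rw [DigitalImage.inducedMap_comp_boundary hn hf]
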